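/- **Setting.** Let $H(m)$ ($m<\omega$) be sets with at least two elements; a finite sequence means an element of $\bigcup_{n}\prod_{i<n}H(i)$. A *local tree creature* $t$ consists of a norm $\mathrm{nor}[t]\in[0,\infty)$, a finite sequence $\eta$ (its root), a nonempty set $\mathrm{pos}(t)$ of one-step extensions $\nu\in\prod_{i\le \mathrm{lh}(\eta)}H(i)$ of $\eta$, and a label $\mathrm{dis}[t]$. A *measured tree creating triple* $(K,\Sigma,\mathbf F)$ consists of a set $K$ of such creatures, a function $\Sigma:K\to\mathcal P(K)$ such that $t\in\Sigma(t)$, and such that $s\in\Sigma(t)$ implies that $s$ has the same root as $t$, $\mathrm{pos}(s)\subseteq\mathrm{pos}(t)$ and $\Sigma(s)\subseteq\Sigma(t)$, and functions $F_t:[0,1]^{\mathrm{pos}(t)}\to[0,1]$ for $t\in K$. It is *strongly finitary* if all $H(m)$ are finite and, for each $\eta$, only finitely many $t\in K$ have root $\eta$. It is *nice* if for every $t\in K$ with root $\eta$, where sequences are indexed by $\nu\in\mathrm{pos}(t)$ and have values in $[0,1]$: * $(\alpha)$ if $r_\nu\le r'_\nu$ for all $\nu$, then $F_t(r_\nu)\le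 F_t(r'_\nu)$; * $(\beta)$ if $\mathrm{nor}[t]>1$, $r^0_\nu+r^1_\nu\ge r_\nu$ for all $\nu$, and $F_t(r_\nu)\ge 2^{-2^{\mathrm{lh}(\eta)}}$, then there are reals $c_0,c_1$ and $s_0,s_1\in\Sigma(t)$ with $c_0+c_1=(1-2^{-2^{\mathrm{lh}(\eta)}})F_t(r_\nu)$ such that, for $\ell<2$, if $c_\ell>0$ then $\mathrm{nor}[s_\ell]\ge\mathrm{nor}[t]-1$, $\mathrm{pos}(s_\ell)\subseteq\{\nu\in\mathrm{pos}(t):r^\ell_\nu>0\}$ and $F_{s_\ell}(r^\ell_\nu:\nu\in\mathrm{pos}(s_\ell))\ge c_\ell$; * $(\gamma)$ $F_t(b\,r_\nu)=b\,F_t(r_\nu)$ for $b\in[0,1]$; * $(\delta)$ for every $(r_\nu)$ and $\varepsilon>0$ there are reals $r'_\nu>r_\nu$ such that $F_t(r''_\nu)<F_t(r_\nu)+\varepsilon$ whenever $r_\nu\le r''_\nu<r'_\nu$ for all $\nu$. Consider systems $p=\langle t^p_\eta:\eta\in T^p\rangle$ where $T^p$ is a tree of finite sequences (with a root, and closed under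 initial segments extending the root) without maximal nodes, and $t^p_\eta\in K$ has root $\eta$ and $\mathrm{pos}(t^p_\eta)$ equal to the set of immediate successors of $\eta$ in $T^p$. For $\eta\in T^p$, $p^{[\eta]}$ is the restriction of $p$ to $\{\nu\in T^p:\eta\trianglelefteq\nu\}$. A *front* of $T^p$ is a set $A\subseteq T^p$ such that every $\omega$-branch through $T^p$ has an initial segment in $A$. For a front $A$, the value $\mu_{p,A}$ at the root of $T^p$ is computed recursively by $\mu_{p,A}(\eta)=1$ if $\eta\in A$, and $\mu_{p,A}(\eta)=F_{t^p_\eta}(\mu_{p,A}(\nu):\nu\in\mathrm{pos}(t^p_\eta))$ otherwise; $\mu^{\mathbf F}(p)$ is the infimum of these values at the root over all fronts $A$ of $T^p$. The forcing notion $\mathbb Q^{\rm mt}_4(K,\Sigma,\mathbf F)$ consists of all such $p$ with $\mu^{\mathbf F}(p)>0$ such that for every $n<\omega$ the set $\{\nu\in T^p:\mathrm{nor}[t^p_\rho]\ge n\text{ for all }\rho\in T^p\text{ properly extending }\nu\}$ contains a front of $T^p$. A condition $q$ is stronger than $p$, written $p\le q$, if $T^q\subseteq T^p$ and $t^q_\eta\in\Sigma(t^p_\eta)$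 for all $\eta\in T^q$. **Theorem.** Let $(K,\Sigma,\mathbf F)$ be a strongly finitary and nice measured tree creating triple. Suppose that $p\in\mathbb Q^{\rm mt}_4(K,\Sigma,\mathbf F)$ and that $\dot\tau_n$ ($n<\omega$) are $\mathbb Q^{\rm mt}_4(K,\Sigma,\mathbf F)$-names for ordinals. Then there are a condition $q\ge p$ and fronts $A_n$ of $T^q$ ($n<\omega$) such that for each $n<\omega$ and each $\nu\in A_n$, $q^{[\nu]}$ is a condition of $\mathbb Q^{\rm mt}_4(K,\Sigma,\mathbf F)$ and decides the value of $\dot\tau_n$ (that is, $q^{[\nu]}\Vdash\dot\tau_n=\check\alpha$ for some ordinal $\alpha$). -/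

import Mathlib

open scoped NNReal unitInterval

universe u

/-! ## Names and the forcing relation

A condition `r` is stronger than `p` when `p ≤ r`. -/

/-- `P`-names: a name is a (small) family of pairs (condition, name). -/
inductive PName (P : Type u) : Type (u + 1)
  | mk (ι : Type u) (cond : ι → P) (elt : ι → PName P) : PName P

namespace PName

variable {P : Type u}

/-- The index type of a name. -/
def Idx : PName P → Type u
  | mk ι _ _ => ι

/-- The conditions occurring in a name. -/
def cond : (x : PName P) → x.Idx → P
  | mk _ c _ => c

/-- The names occurring in a name. -/
def elt : (x : PName P) → x.Idx → PName P
  | mk _ _ a => a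

/-- The canonical (check) name of a ground model set `a`: it consists of all pairs `(p, check b)`
with `b ∈ a` and `p` any condition. -/
def check (P : Type u) : PSet.{u} → PName P
  | ⟨ι, a⟩ => mk (ι × P) Prod.snd (fun i => check P (a i.1))

variable [Preorder P]

/-- `ForcesEq x y p`: the condition `p` forces `x = y`.  That is, whenever `(c, x₀)` belongs to
`x`, it is dense above `p` and `c` that `x₀` is forced to be equal to some `y₀` such that
`(d, y₀)` belongs to `y` and `d` is weaker than the current condition; and symmetrically. -/
def ForcesEq : PName P → PName P → P → Prop
  | mk ι c a, mk κ d b => fun p =>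
    (∀ (i : ι) (r : P), p ≤ r → c i ≤ r →
      ∃ s, r ≤ s ∧ ∃ j : κ, d j ≤ s ∧ ForcesEq (a i) (b j) s) ∧
    (∀ (j : κ) (r : P), p ≤ r → d j ≤ r →
      ∃ s, r ≤ s ∧ ∃ i : ι, c i ≤ s ∧ ForcesEq (a i) (b j) s)

/-- `ForcesMem x y p`: the condition `p` forces `x ∈ y`. -/
def ForcesMem (x y : PName P) (p : P) : Prop :=
  ∀ r, p ≤ r → ∃ s, r ≤ s ∧ ∃ j : y.Idx, y.cond j ≤ s ∧ ForcesEq x (y.elt j) s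

/-- `p` forces that `x` is a transitive set: `∀ y z, y ∈ x → z ∈ y → z ∈ x`. -/
def ForcesTransitive (x : PName P) (p : P) : Prop :=
  ∀ y z : PName P, ∀ r, p ≤ r → ForcesMem y x r → ∀ s, r ≤ s → ForcesMem z y s → ForcesMem z x s

/-- `p` forces that `x` is an ordinal, i.e. a transitive set of transitive sets. -/
def ForcesOrdinal (x : PName P) (p : P) : Prop :=
  ForcesTransitive x p ∧
    ∀ y : PName P, ∀ r, p ≤ r → ForcesMem y x r → ForcesTransitive y r

/-- `x` is a name for an ordinal: every condition forces that `x` is an ordinal. -/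
def IsOrdinalName (x : PName P) : Prop := ∀ p : P, ForcesOrdinal x p

/-- The condition `p` decides the value of (the name for an ordinal) `x`: for some ordinal `α`
of the ground model, `p` forces `x = α`. -/
def DecidedBy (x : PName P) (p : P) : Prop :=
  ∃ α : Ordinal.{u}, ForcesEq x (check P α.toPSet) p

end PName

namespace MeasuredCreature

variable {X : Type u}

/-! ## Finite sequences, trees, fronts

Finite sequences are lists; `ν <+: η` says that `ν` is an initial segment of `η`. -/

/-- The finite sequences `η` with `η ∈ ∏_{i < n} H i` for some `n`. -/
def finSeq (H : ℕ → Set X) : Set (List X) :=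
  {η | ∀ (i : ℕ) (h : i < η.length), η[i] ∈ H i}

/-- Proper initial segment. -/
def StrictPrefix (ν η : List X) : Prop := ν <+: η ∧ ν ≠ η

/-- The initial segment `x ↾ k` of an infinite sequence. -/
def restr (x : ℕ → X) (k : ℕ) : List X := (List.range k).map x

/-- The immediate successors of `η` in `T`. -/
def suc (T : Set (List X)) (η : List X) : Set (List X) :=
  {ν | ν ∈ T ∧ StrictPrefix η ν ∧ ν.length = η.length + 1}

/-- `x` is an `ω`-branch through the tree `T`.  Trees need not contain the initial segments of
their root, so this says that all sufficiently long initial segments of `x` are in `T`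
(equivalently, all those at least as long as the root). -/
def IsBranch (T : Set (List X)) (x : ℕ → X) : Prop := ∃ m, ∀ k, m ≤ k → restr x k ∈ T

/-- `A` is a front of `T`: every `ω`-branch through `T` has an initial segment in `A`. -/
def IsFront (T A : Set (List X)) : Prop :=
  A ⊆ T ∧ ∀ x : ℕ → X, IsBranch T x → ∃ k, restr x k ∈ A

/-! ## Tree creatures and measured triples -/

/-- Local tree creatures for `H`.  The component `val` is `{(root, ν) : ν ∈ pos}` and is recovered
below; `dis` takes values in an arbitrary set `D` of labels. -/
structure TreeCreature (H : ℕ → Set X) (D : Type u) where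
  /-- the norm -/
  nor : ℝ≥0
  /-- the unique element of the domain of `val` -/
  root : List X
  /-- the range of `val` -/
  pos : Set (List X)
  /-- the third component of the creature -/
  dis : D
  root_mem : root ∈ finSeq H
  pos_nonempty : pos.Nonempty
  pos_sub : ∀ ν ∈ pos, ν ∈ finSeq H ∧ StrictPrefix root ν ∧ ν.length = root.length + 1

/-- The relation `val[t]`. -/
def TreeCreature.val {H : ℕ → Set X} {D : Type u} (t : TreeCreature H D) :
    Set (List X × List X) :=
  {z | z.1 = t.root ∧ z.2 ∈ t.pos}

/-- Measured tree creating triples `(K, Σ, F)`: `(K, Σ)` is a local tree creating pair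
(`comp` is `Σ`) and `F t` is a function from `[0,1]^{pos(t)}` to `[0,1]` for each `t ∈ K`.
The clause `t ∈ Σ(t)` makes the order of the associated forcing notions reflexive. -/
structure MeasuredTriple (H : ℕ → Set X) (D : Type u) where
  K : Set (TreeCreature H D)
  comp : K → Set K
  self_mem : ∀ t, t ∈ comp t
  root_eq : ∀ t, ∀ s ∈ comp t, s.1.root = t.1.root
  val_subset : ∀ t, ∀ s ∈ comp t, s.1.val ⊆ t.1.val
  trans : ∀ t, ∀ s ∈ comp t, comp s ⊆ comp t
  F : (t : K) → (t.1.pos → I) → I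

section

variable {H : ℕ → Set X} {D : Type u}

/-- `F_t(r_ν : ν ∈ pos(t))`, where `r` may be defined also outside `pos(t)`. -/
def MeasuredTriple.avg (M : MeasuredTriple H D) (t : M.K) (r : List X → I) : I :=
  M.F t (fun ν => r ν)

/-- Strongly finitary: each `H m` is finite, and so is the set of all `t ∈ K` with root `η`,
for each `η`. -/
def MeasuredTriple.StronglyFinitary (M : MeasuredTriple H D) : Prop :=
  (∀ m, (H m).Finite) ∧ ∀ η : List X, {t : TreeCreature H D | t ∈ M.K ∧ t.root = η}.Finite

/-- The error term `2^(-2^n)`. -/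
noncomputable def err (n : ℕ) : ℝ := ((2 : ℝ) ^ (2 ^ n))⁻¹

/-- Nice measured tree creating triples. -/
structure MeasuredTriple.Nice (M : MeasuredTriple H D) : Prop where
  mono : ∀ (t : M.K) (r r' : List X → I), (∀ ν ∈ t.1.pos, r ν ≤ r' ν) →
    M.avg t r ≤ M.avg t r'
  split : ∀ (t : M.K), 1 < t.1.nor → ∀ (r : List X → I) (r' : Fin 2 → List X → I),
    (∀ ν ∈ t.1.pos, (r ν : ℝ) ≤ (r' 0 ν : ℝ) + (r' 1 ν : ℝ)) →
    err t.1.root.length ≤ (M.avg t r : ℝ) →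
    ∃ (c : Fin 2 → ℝ) (s : Fin 2 → M.K), (∀ l, s l ∈ M.comp t) ∧
      c 0 + c 1 = (1 - err t.1.root.length) * (M.avg t r : ℝ) ∧
      ∀ l, 0 < c l →
        (t.1.nor : ℝ) - 1 ≤ ((s l).1.nor : ℝ) ∧
        (s l).1.pos ⊆ {ν | ν ∈ t.1.pos ∧ 0 < r' l ν} ∧
        c l ≤ (M.avg (s l) (r' l) : ℝ)
  homogeneous : ∀ (t : M.K) (b : I) (r : List X → I),
    M.avg t (fun ν => b * r ν) = b * M.avg t r
  semicont : ∀ (t : M.K) (r : List X → I) (ε : ℝ), 0 < ε →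
    ∃ r' : List X → ℝ, (∀ ν ∈ t.1.pos, (r ν : ℝ) < r' ν) ∧
      ∀ r'' : List X → I, (∀ ν ∈ t.1.pos, r ν ≤ r'' ν ∧ (r'' ν : ℝ) < r' ν) →
        (M.avg t r'' : ℝ) < (M.avg t r : ℝ) + ε

/-! ## The forcing notions -/

/-- The elements `p = ⟨t_η : η ∈ T⟩` of the forcing without any norm requirement: `T` is a
tree without maximal nodes, and `t_η ∈ K` is a creature with root `η` whose possibilities are the
immediate successors of `η` in `T`.  (The root of the tree is determined by `T`.) -/
structure TreeCond (M : MeasuredTriple H D) where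
  T : Set (List X)
  root : List X
  root_mem : root ∈ T
  root_prefix : ∀ ν ∈ T, root <+: ν
  convex : ∀ ν η : List X, root <+: ν → ν <+: η → η ∈ T → ν ∈ T
  subset : T ⊆ finSeq H
  no_max : ∀ ν ∈ T, ∃ ρ ∈ T, StrictPrefix ν ρ
  t : T → M.K
  t_root : ∀ η : T, (t η).1.root = η
  t_pos : ∀ η : T, (t η).1.pos = suc T η

namespace TreeCond

variable {M : MeasuredTriple H D}

/-- `p^{[η]}`, the part of `p` above the node `η` of its tree. -/
def above (p : TreeCond M) (η : p.T) : TreeCond M where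
  T := {ν | ν ∈ p.T ∧ (η : List X) <+: ν}
  root := η
  root_mem := ⟨η.2, List.prefix_refl _⟩
  root_prefix := fun _ h => h.2
  convex := fun ν ρ h1 h2 h3 =>
    ⟨p.convex ν ρ ((p.root_prefix η η.2).trans h1) h2 h3.1, h1⟩
  subset := fun _ h => p.subset h.1
  no_max := fun ν h => by
    obtain ⟨ρ, hρ, h'⟩ := p.no_max ν h.1
    exact ⟨ρ, ⟨hρ, h.2.trans h'.1⟩, h'⟩
  t := fun ν => p.t ⟨ν, ν.2.1⟩
  t_root := fun ν => p.t_root ⟨ν, ν.2.1⟩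
  t_pos := fun ν => by
    rw [p.t_pos ⟨ν, ν.2.1⟩]
    ext ρ
    constructor
    · rintro ⟨h1, h2, h3⟩
      exact ⟨⟨h1, ν.2.2.trans h2.1⟩, h2, h3⟩
    · rintro ⟨h1, h2, h3⟩
      exact ⟨h1.1, h2, h3⟩

/-- `Val p A f η a` says that the value `μ^f_{p,A}(η)` is `a`: the value is `f η` if `η ∈ A`, and
it is `F_{t_η}` of the values at the immediate successors of `η` if `η ∉ A`.  If `A` is a front,
there is exactly one such `a` for `η` the root. -/
inductive Val (p : TreeCond M) (A : Set (List X)) (f : List X → I) : List X → I → Prop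
  | front (η : List X) (h : η ∈ A) : Val p A f η (f η)
  | step (η : p.T) (h : (η : List X) ∉ A) (g : List X → I)
      (hg : ∀ ν ∈ (p.t η).1.pos, Val p A f ν (g ν)) : Val p A f η (M.avg (p.t η) g)

/-- `μ^F(p)`: the infimum, over all fronts `A` of the tree, of the value at the root computed
from the constant function `1` on `A`. -/
noncomputable def mu (p : TreeCond M) : ℝ :=
  sInf {a : ℝ | ∃ (A : Set (List X)) (v : I),
    IsFront p.T A ∧ Val p A (fun _ => 1) p.root v ∧ a = v}

/-- The norm requirement: for every `n`, the set of all nodes above which all norms are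
at least `n` contains a front. -/
def NormsLarge (p : TreeCond M) : Prop :=
  ∀ n : ℕ, ∃ A, IsFront p.T A ∧ ∀ ν ∈ A, ∀ ρ : p.T, StrictPrefix ν ρ → (n : ℝ≥0) ≤ (p.t ρ).1.nor

end TreeCond

/-- The forcing notion `ℚ^{mt}_4(K, Σ, F)`. -/
structure MtCond (M : MeasuredTriple H D) extends TreeCond M where
  norms : toTreeCond.NormsLarge
  mu_pos : 0 < toTreeCond.mu

/-- `p ≤ q` (that is, `q` is stronger than `p`) iff `T^q ⊆ T^p` and `t^q_η ∈ Σ(t^p_η)` for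
all `η ∈ T^q`. -/
instance (M : MeasuredTriple H D) : Preorder (MtCond M) where
  le p q := ∃ h : q.T ⊆ p.T, ∀ η : q.T, q.t η ∈ M.comp (p.t ⟨η, h η.2⟩)
  le_refl p := ⟨subset_rfl, fun η => M.self_mem _⟩
  le_trans p q r := by
    rintro ⟨h1, h2⟩ ⟨h3, h4⟩
    exact ⟨h3.trans h1, fun η => M.trans _ _ (h2 ⟨η, h3 η.2⟩) (h4 η)⟩

end

end MeasuredCreature

/-! Call a function on the nodes subharmonic if its value never exceeds the `F`-average of its
values at the successors. Such a function bounds the measure from below at the root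
(`Subharm.le_mu`), so every lower estimate of a measure reduces to exhibiting one. The measure of a
node, taken as the limit of the values computed from levels, is itself subharmonic by (δ) and
finiteness, and a Lebesgue density argument (`exists_le_meas`) finds nodes of measure close to 1
above any node of positive measure.

The heart is `MtCond.exists_attains`: if every condition stronger than `p` has a node in `G`, then
some well-founded tree inside `p` with terminal nodes in `G` has almost the measure of `p`.
Otherwise the deficit at the root (measure minus best attainable value) is noticeable. Two
applications of (β) show that at a node of noticeable deficit the creature can be shrunk to
successors of noticeable deficit at little cost (`Deficient.exists_comp`). Iterating yields a
condition all of whose nodes are deficient (`Deficient.exists_mtCond`); since nodes of `G` are not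
deficient, this condition misses `G`, a contradiction.

For the fusion, stage `n` runs inside a condition deciding the `n`-th name, and `G` consists of
roots of stronger conditions that decide the next name, with measure near 1 and large norms. The
well-founded trees are stacked, the ambient condition being replaced at each terminal node. The
losses are absorbed by the weights 1 - 2⁻ⁿ, so a positive subharmonic function survives;
well-foundedness makes every branch pass through every stage, so the nodes of stage `n` form a
front. -/

namespace PName

/-! ### Forcing equality, and densely deciding names for ordinals -/

variable {P : Type u} [Preorder P]

theorem forcesEq_iff (x y : PName P) (p : P) : ForcesEq x y p ↔
    (∀ (i : x.Idx) (r : P), p ≤ r → x.cond i ≤ r →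
      ∃ s, r ≤ s ∧ ∃ j : y.Idx, y.cond j ≤ s ∧ ForcesEq (x.elt i) (y.elt j) s) ∧
    (∀ (j : y.Idx) (r : P), p ≤ r → y.cond j ≤ r →
      ∃ s, r ≤ s ∧ ∃ i : x.Idx, x.cond i ≤ s ∧ ForcesEq (x.elt i) (y.elt j) s) := by
  cases x; cases y; rw [ForcesEq]; rfl

theorem ForcesEq.mono {x y : PName P} {p q : P} (h : ForcesEq x y p) (hpq : p ≤ q) :
    ForcesEq x y q := by
  rw [forcesEq_iff] at h ⊢
  exact ⟨fun i r hr => h.1 i r (hpq.trans hr), fun i r hr => h.2 i r (hpq.trans hr)⟩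

theorem ForcesEq.refl (x : PName P) (p : P) : ForcesEq x x p := by
  induction x generalizing p with
  | mk ι c a ih =>
    rw [forcesEq_iff]
    exact ⟨fun i r _ hc => ⟨r, le_rfl, i, hc, ih i r⟩, fun i r _ hc => ⟨r, le_rfl, i, hc, ih i r⟩⟩

theorem ForcesEq.symm {x y : PName P} {p : P} (h : ForcesEq x y p) : ForcesEq y x p := by
  induction x generalizing y p with
  | mk ι c a ih =>
    rw [forcesEq_iff] at h ⊢
    constructor
    · intro j r hr hj
      obtain ⟨s, hs, i, hi, he⟩ := h.2 j r hr hj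
      exact ⟨s, hs, i, hi, ih i he⟩
    · intro j r hr hj
      obtain ⟨s, hs, i, hi, he⟩ := h.1 j r hr hj
      exact ⟨s, hs, i, hi, ih j he⟩

theorem ForcesEq.trans {x y z : PName P} {p : P} (h : ForcesEq x y p) (h' : ForcesEq y z p) :
    ForcesEq x z p := by
  induction x generalizing y z p with
  | mk ι c a ih =>
    rw [forcesEq_iff] at h h' ⊢
    constructor
    · intro i r hr hi
      obtain ⟨s, hs, j, hj, he⟩ := h.1 i r hr hi
      obtain ⟨s', hs', k, hk, he'⟩ := h'.1 j s (hr.trans hs) hj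
      exact ⟨s', hs.trans hs', k, hk, ih i (he.mono hs') he'⟩
    · intro k r hr hk
      obtain ⟨s, hs, j, hj, he⟩ := h'.2 k r hr hk
      obtain ⟨s', hs', i, hi, he'⟩ := h.2 j s (hr.trans hs) hj
      exact ⟨s', hs.trans hs', i, hi, ih i he' (he.mono hs')⟩

theorem ForcesEq.mem_left {x x' y : PName P} {p : P} (h : ForcesEq x x' p)
    (hm : ForcesMem x y p) : ForcesMem x' y p := by
  intro r hr
  obtain ⟨s, hs, j, hj, he⟩ := hm r hr
  exact ⟨s, hs, j, hj, (h.mono (hr.trans hs)).symm.trans he⟩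

theorem ForcesEq.mem_right {x y y' : PName P} {p : P} (h : ForcesEq y y' p)
    (hm : ForcesMem x y p) : ForcesMem x y' p := by
  intro r hr
  obtain ⟨s, hs, j, hj, he⟩ := hm r hr
  obtain ⟨s', hs', k, hk, he'⟩ := ((forcesEq_iff _ _ _).1 h).1 j s (hr.trans hs) hj
  exact ⟨s', hs.trans hs', k, hk, (he.mono hs').trans he'⟩

theorem forcesMem_elt (x : PName P) (i : x.Idx) {p : P} (h : x.cond i ≤ p) :
    ForcesMem (x.elt i) x p :=
  fun r hr => ⟨r, le_rfl, i, h.trans hr, ForcesEq.refl _ _⟩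

theorem ForcesOrdinal.mono {x : PName P} {p q : P} (h : ForcesOrdinal x p) (hpq : p ≤ q) :
    ForcesOrdinal x q :=
  ⟨fun y z r hr => h.1 y z r (hpq.trans hr), fun y r hr => h.2 y r (hpq.trans hr)⟩

/-- Elements of ordinals are ordinals. -/
theorem ForcesOrdinal.of_mem {x y : PName P} {p : P} (h : ForcesOrdinal x p)
    (hy : ForcesMem y x p) : ForcesOrdinal y p :=
  ⟨h.2 y p le_rfl hy, fun z r hr hz => h.2 z r hr (h.1 y z p le_rfl hy r hr hz)⟩

theorem equiv_of_forcesEq_check {a b : PSet.{u}} {p : P}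
    (h : ForcesEq (check P a) (check P b) p) : a.Equiv b := by
  induction a generalizing b p with
  | mk ι a ih =>
    cases b with
    | mk κ b =>
      rw [check, check, ForcesEq] at h
      constructor
      · intro i
        obtain ⟨s, -, j, -, he⟩ := h.1 (i, p) p le_rfl le_rfl
        exact ⟨j.1, ih i he⟩
      · intro j
        obtain ⟨s, -, i, -, he⟩ := h.2 (j, p) p le_rfl le_rfl
        exact ⟨i.1, ih i.1 he⟩

theorem forcesEq_check_of_equiv {a b : PSet.{u}} (h : a.Equiv b) (p : P) :
    ForcesEq (check P a) (check P b) p := by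
  induction a generalizing b p with
  | mk ι a ih =>
    cases b with
    | mk κ b =>
      rw [check, check, ForcesEq]
      constructor
      · intro i r _ _
        obtain ⟨j, hj⟩ := h.1 i.1
        exact ⟨r, le_rfl, (j, r), le_rfl, ih i.1 hj r⟩
      · intro j r _ _
        obtain ⟨i, hi⟩ := h.2 j.1
        exact ⟨r, le_rfl, (i, r), le_rfl, ih i hi r⟩

theorem eq_of_forcesEq_check {α β : Ordinal.{u}} {p : P}
    (h : ForcesEq (check P α.toPSet) (check P β.toPSet) p) : α = β := by
  have := PSet.rank_congr (equiv_of_forcesEq_check h)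
  rwa [Ordinal.rank_toPSet, Ordinal.rank_toPSet] at this

theorem exists_idx_check {a b : PSet.{u}} (h : a ∈ b) (p : P) :
    ∃ j : (check P b).Idx, (check P b).cond j ≤ p ∧ ForcesEq (check P a) ((check P b).elt j) p := by
  cases b with
  | mk κ b =>
    obtain ⟨j, hj⟩ := h
    exact ⟨(j, p), le_rfl, forcesEq_check_of_equiv hj p⟩

theorem exists_mem_of_idx_check {b : PSet.{u}} (j : (check P b).Idx) :
    ∃ a ∈ b, ∀ p, ForcesEq (check P a) ((check P b).elt j) p := by
  cases b with
  | mk κ b => exact ⟨b j.1, PSet.Mem.mk b j.1, fun p => ForcesEq.refl _ _⟩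

theorem forcesMem_check {a b : PSet.{u}} (h : a ∈ b) (p : P) :
    ForcesMem (check P a) (check P b) p :=
  fun r _ => ⟨r, le_rfl, exists_idx_check h r⟩

/-- If a condition forces `x` to be an ordinal, then some stronger condition decides `x`. -/
theorem ForcesOrdinal.exists_decidedBy {x : PName P} {p : P} (h : ForcesOrdinal x p) :
    ∃ r, p ≤ r ∧ x.DecidedBy r := by
  induction x generalizing p with
  | mk ι c a ih =>
    set x : PName P := mk ι c a with hx
    have dec : ∀ (i : ι) (r : P), p ≤ r → c i ≤ r → ∃ s, r ≤ s ∧ (a i).DecidedBy s := by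
      intro i r hr hi
      exact ih i ((h.mono hr).of_mem (forcesMem_elt x i hi))
    -- `bad α r` expresses that `r` forces α ∉ x. The least such α, over all conditions above `p`,
    -- will be the value.
    let bad : Ordinal.{u} → P → Prop := fun α r => ∀ s, r ≤ s → ¬ ForcesMem (check P α.toPSet) x s
    have ex : ∃ α : Ordinal.{u}, ∃ r, p ≤ r ∧ bad α r := by
      classical
      let f : ι × P → Ordinal.{u} := fun z =>
        if hz : (a z.1).DecidedBy z.2 then hz.choose else 0
      -- The index type `ι × P` is small, so the decided values of elements of `x` are bounded; a
      -- strict bound is never forced into `x`.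
      obtain ⟨α, hα⟩ : ∃ α, ∀ z, f z < α := by
        refine ⟨Order.succ (⨆ z, f z), fun z => Order.lt_succ_of_le ?_⟩
        exact Ordinal.le_iSup f z
      refine ⟨α, p, le_rfl, fun s hs hm => ?_⟩
      obtain ⟨s₁, h₁, i, hi, he⟩ := hm s le_rfl
      obtain ⟨s₂, h₂, hd⟩ := dec i s₁ (hs.trans h₁) hi
      have h3 : ForcesEq (a i) (check P (f (i, s₂)).toPSet) s₂ := by
        simp only [f]
        rw [dif_pos hd]
        exact hd.choose_spec
      have h4 := eq_of_forcesEq_check ((ForcesEq.mono he h₂).trans h3)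
      exact absurd (hα (i, s₂)) (by rw [← h4]; exact lt_irrefl _)
    -- By minimality every β < α is densely forced into `x` above `r`. Conversely an element of `x`
    -- with value ≥ α would put α itself into `x`, by transitivity.
    obtain ⟨α, ⟨r, hpr, hr⟩, hmin⟩ := WellFounded.has_min (wellFounded_lt (α := Ordinal.{u}))
      {α | ∃ r, p ≤ r ∧ bad α r} ex
    refine ⟨r, hpr, α, ?_⟩
    rw [forcesEq_iff]
    constructor
    · intro i r' hr' hi
      obtain ⟨s, hs, β, hβ⟩ := dec i r' (hpr.trans hr') hi
      have hmem : ForcesMem (a i) x s := forcesMem_elt x i (le_trans hi hs)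
      have hβα : β < α := by
        rcases lt_trichotomy β α with h1 | h1 | h1
        · exact h1
        · subst h1
          exact absurd (hβ.mem_left hmem) (hr s (hr'.trans hs))
        · have h2 : ForcesMem (check P α.toPSet) (check P β.toPSet) s :=
            forcesMem_check (Ordinal.mem_toPSet_iff.2 ⟨α, h1, PSet.Equiv.refl _⟩) s
          have h3 := hβ.symm.mem_right h2
          exact absurd (h.1 _ _ s ((hpr.trans hr').trans hs) hmem s le_rfl h3)
            (hr s (hr'.trans hs))
      obtain ⟨j, hj, he⟩ :=
        exists_idx_check (Ordinal.mem_toPSet_iff.2 ⟨β, hβα, PSet.Equiv.refl _⟩) s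
      exact ⟨s, hs, j, hj, hβ.trans he⟩
    · intro j r' hr' _
      obtain ⟨b, hb, he⟩ := exists_mem_of_idx_check j
      obtain ⟨β, hβ, hbβ⟩ := Ordinal.mem_toPSet_iff.1 hb
      have h1 : ¬ bad β r' := fun h1 => hmin β ⟨r', hpr.trans hr', h1⟩ hβ
      simp only [bad, not_forall, not_not] at h1
      obtain ⟨s, hs, hm⟩ := h1
      obtain ⟨s', hs', i, hi, he'⟩ := hm s le_rfl
      exact ⟨s', hs.trans hs', i, hi,
        (he'.symm.trans (forcesEq_check_of_equiv hbβ s').symm).trans (he s')⟩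

theorem DecidedBy.mono {x : PName P} {p q : P} (h : x.DecidedBy p) (hpq : p ≤ q) :
    x.DecidedBy q := by
  obtain ⟨α, hα⟩ := h
  exact ⟨α, hα.mono hpq⟩

end PName

/-! ### Finite sequences, branches and elementary properties of triples -/

namespace MeasuredCreature

variable {X : Type u}

theorem length_restr (x : ℕ → X) (k : ℕ) : (restr x k).length = k := by
  simp [restr]

theorem restr_succ (x : ℕ → X) (k : ℕ) : restr x (k + 1) = restr x k ++ [x k] := by
  simp [restr, List.range_succ]

theorem restr_prefix (x : ℕ → X) {k l : ℕ} (h : k ≤ l) : restr x k <+: restr x l := by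
  induction l, h using Nat.le_induction with
  | base => exact List.prefix_refl _
  | succ l _ ih => rw [restr_succ]; exact ih.trans (List.prefix_append _ _)

theorem eq_of_prefix_length {a b c : List X} (ha : a <+: c) (hb : b <+: c)
    (h : a.length = b.length) : a = b := by
  rw [List.prefix_iff_eq_take] at ha hb
  rw [ha, hb, h]

theorem eq_restr_of_prefix {x : ℕ → X} {k : ℕ} {ν : List X} (h : ν <+: restr x k) :
    ν = restr x ν.length := by
  have h1 := h.length_le
  rw [length_restr] at h1
  exact eq_of_prefix_length h (restr_prefix x h1) (length_restr _ _).symm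

theorem StrictPrefix.length_lt {a b : List X} (h : StrictPrefix a b) : a.length < b.length :=
  lt_of_le_of_ne h.1.length_le fun h' => h.2 (h.1.eq_of_length h')

theorem StrictPrefix.of_prefix {a b c : List X} (h : a <+: b) (h' : StrictPrefix b c) :
    StrictPrefix a c :=
  ⟨h.trans h'.1, fun e => absurd h'.length_lt (by rw [← e]; exact not_lt.2 h.length_le)⟩

/-- A set of nodes each of which has an immediate successor in the set contains a branch. -/
theorem exists_branch {S : Set (List X)}
    (hS : ∀ η ∈ S, ∃ ν ∈ S, StrictPrefix η ν ∧ ν.length = η.length + 1) {η : List X}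
    (hη : η ∈ S) : ∃ x : ℕ → X, restr x η.length = η ∧ ∀ k, η.length ≤ k → restr x k ∈ S := by
  choose! g hgS hgp hgl using hS
  let f : ℕ → List X := fun n => g^[n] η
  have hfs : ∀ n, f (n + 1) = g (f n) := fun n => Function.iterate_succ_apply' g n η
  have hf : ∀ n, f n ∈ S := by
    intro n
    induction n with
    | zero => exact hη
    | succ n ih => rw [hfs]; exact hgS _ ih
  have hfl : ∀ n, (f n).length = η.length + n := by
    intro n
    induction n with
    | zero => rfl
    | succ n ih => rw [hfs, hgl _ (hf n), ih]; rfl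
  have hfp : ∀ {m n}, m ≤ n → f m <+: f n := by
    intro m n h
    induction n, h using Nat.le_induction with
    | base => exact List.prefix_refl _
    | succ n _ ih => rw [hfs]; exact ih.trans (hgp _ (hf n)).1
  -- The sequence `f (i + 1)` always has length greater than `i`, and the `f n` cohere, so reading
  -- the entry there is harmless.
  let x : ℕ → X := fun i => (f (i + 1))[i]'(by rw [hfl]; omega)
  have key : ∀ k n, k ≤ (f n).length → restr x k <+: f n := by
    intro k
    induction k with
    | zero => intro n _; simp [restr]
    | succ k ih =>
      intro n hn
      have hp : restr x (k + 1) = (f n).take (k + 1) := by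
        rw [restr_succ, List.take_succ_eq_append_getElem (by omega)]
        congr 1
        · have := ih n (by omega)
          rw [List.prefix_iff_eq_take, length_restr] at this
          exact this
        · congr 1
          rcases le_total (k + 1) n with h | h
          · exact (hfp h).getElem _
          · exact ((hfp h).getElem (by omega)).symm
      rw [hp]
      exact List.take_prefix _ _
  have hx : ∀ k, η.length ≤ k → restr x k = f (k - η.length) := by
    intro k hk
    refine (key k _ ?_).eq_of_length ?_
    · rw [hfl]; omega
    · rw [hfl, length_restr]; omega
  refine ⟨x, ?_, fun k hk => ?_⟩
  · rw [hx _ le_rfl, Nat.sub_self]; rfl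
  · rw [hx k hk]; exact hf _

variable {H : ℕ → Set X} {D : Type u} {M : MeasuredTriple H D}

theorem finite_finSeq (hH : ∀ m, (H m).Finite) (n : ℕ) :
    {η | η ∈ finSeq H ∧ η.length = n}.Finite := by
  induction n with
  | zero => exact (Set.finite_singleton []).subset fun η h => List.length_eq_zero_iff.1 h.2
  | succ n ih =>
    refine (Set.Finite.image2 (fun l a => l ++ [a]) ih (hH n)).subset ?_
    rintro η ⟨h1, h2⟩
    have hne : η ≠ [] := by rintro rfl; simp at h2
    refine ⟨η.dropLast, ⟨fun i h => ?_, by simp [h2]⟩, η.getLast hne, ?_, ?_⟩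
    · have := h1 i (by simp at h; omega)
      simpa using this
    · have := h1 n (by omega)
      rw [List.getLast_eq_getElem]
      simpa [h2] using this
    · exact List.dropLast_append_getLast hne

namespace MeasuredTriple

theorem StronglyFinitary.finite_pos (h : M.StronglyFinitary) (t : M.K) : t.1.pos.Finite :=
  (finite_finSeq h.1 (t.1.root.length + 1)).subset fun ν hν =>
    ⟨(t.1.pos_sub ν hν).1, (t.1.pos_sub ν hν).2.2⟩

theorem avg_congr (t : M.K) {r r' : List X → I} (h : ∀ ν ∈ t.1.pos, r ν = r' ν) :
    M.avg t r = M.avg t r' := by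
  unfold avg
  congr 1
  funext ν
  exact h ν ν.2

theorem pos_subset {t s : M.K} (h : s ∈ M.comp t) : s.1.pos ⊆ t.1.pos := by
  intro ν hν
  exact (M.val_subset t s h (show ((s.1.root, ν) : List X × List X) ∈ s.1.val from ⟨rfl, hν⟩)).2

/-- A constant is a multiple of 1 and `F` is bounded by 1, so homogeneity controls averages of
constants. With `b = 0` this also shows that the average of 0 is 0. -/
theorem Nice.avg_le (hn : M.Nice) (t : M.K) {r : List X → I} {b : I}
    (h : ∀ ν ∈ t.1.pos, r ν ≤ b) : M.avg t r ≤ b := by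
  calc M.avg t r ≤ M.avg t (fun _ => b * 1) := hn.mono t _ _ fun ν hν => by simpa using h ν hν
    _ = b * M.avg t (fun _ => 1) := hn.homogeneous t b _
    _ ≤ b := unitInterval.mul_le_left

end MeasuredTriple

/-! ### Subharmonic functions, the measure of a node, and density -/

namespace TreeCond

theorem root_length_le (p : TreeCond M) {η : List X} (h : η ∈ p.T) :
    p.root.length ≤ η.length :=
  (p.root_prefix η h).length_le

theorem mem_of_mem_pos (p : TreeCond M) {η : p.T} {ν : List X} (h : ν ∈ (p.t η).1.pos) :
    ν ∈ p.T := by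
  rw [p.t_pos] at h; exact h.1

theorem prefix_of_mem_pos (p : TreeCond M) {η : p.T} {ν : List X} (h : ν ∈ (p.t η).1.pos) :
    (η : List X) <+: ν := by
  rw [p.t_pos] at h; exact h.2.1.1

theorem length_of_mem_pos (p : TreeCond M) {η : p.T} {ν : List X} (h : ν ∈ (p.t η).1.pos) :
    ν.length = (η : List X).length + 1 := by
  rw [p.t_pos] at h; exact h.2.2

/-- `u` is subharmonic on `p`: its value at a node is at most the `F`-average of its values at the
immediate successors. -/
def Subharm (p : TreeCond M) (u : List X → I) : Prop :=
  ∀ η : p.T, u η ≤ M.avg (p.t η) u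

theorem Subharm.above {p : TreeCond M} {u : List X → I} (h : p.Subharm u) (ν : p.T) :
    (p.above ν).Subharm u :=
  fun η => h ⟨η, η.2.1⟩

/-- On the front the value is 1, which dominates `u`; monotonicity (α) carries the inequality down
to the root. This is the only tool used below to prove that a measure is positive. -/
theorem Subharm.le_val {p : TreeCond M} (hn : M.Nice) {u : List X → I} (h : p.Subharm u)
    {A : Set (List X)} {η : List X} {v : I} (hv : Val p A (fun _ => 1) η v) : u η ≤ v := by
  induction hv with
  | front η _ => exact unitInterval.le_one'
  | step η _ g _ ih => exact (h η).trans (hn.mono _ _ _ ih)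

theorem isFront_root (p : TreeCond M) : IsFront p.T {p.root} := by
  refine ⟨by rintro _ rfl; exact p.root_mem, fun x ⟨m, hm⟩ => ⟨p.root.length, ?_⟩⟩
  exact (eq_restr_of_prefix (p.root_prefix _ (hm m le_rfl))).symm

theorem Subharm.le_mu {p : TreeCond M} (hn : M.Nice) {u : List X → I} (h : p.Subharm u) :
    (u p.root : ℝ) ≤ p.mu := by
  refine le_csInf ⟨((1 : I) : ℝ), {p.root}, 1, p.isFront_root, Val.front _ rfl, rfl⟩ ?_
  rintro a ⟨A, v, -, hv, rfl⟩
  exact_mod_cast h.le_val hn hv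

open Classical in
/-- The value at a node computed from the front consisting of its extensions by `k` steps. -/
noncomputable def lev (p : TreeCond M) : ℕ → List X → I
  | 0, _ => 1
  | k + 1, η => if h : η ∈ p.T then M.avg (p.t ⟨η, h⟩) (lev p k) else 1

theorem lev_succ (p : TreeCond M) (k : ℕ) (η : p.T) :
    p.lev (k + 1) η = M.avg (p.t η) (p.lev k) := by
  rw [lev, dif_pos η.2]

theorem lev_antitone (p : TreeCond M) (hn : M.Nice) (η : List X) :
    Antitone fun k => p.lev k η := by
  refine antitone_nat_of_succ_le fun k => ?_
  induction k generalizing η with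
  | zero => exact unitInterval.le_one'
  | succ k ih =>
    by_cases h : η ∈ p.T
    · rw [p.lev_succ (k + 1) ⟨η, h⟩, p.lev_succ k ⟨η, h⟩]
      exact hn.mono _ _ _ fun ν _ => ih ν
    · rw [lev, dif_neg h, lev, dif_neg h]

theorem bddBelow_lev (p : TreeCond M) (η : List X) :
    BddBelow (Set.range fun k => (p.lev k η : ℝ)) :=
  ⟨0, by rintro _ ⟨k, rfl⟩; exact (p.lev k η).2.1⟩

/-- The measure of the part of `p` above a node. -/
noncomputable def meas (p : TreeCond M) (η : List X) : I :=
  ⟨⨅ k, (p.lev k η : ℝ), le_ciInf fun k => (p.lev k η).2.1,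
    (ciInf_le (p.bddBelow_lev η) 0).trans (p.lev 0 η).2.2⟩

theorem meas_le_lev (p : TreeCond M) (η : List X) (k : ℕ) : p.meas η ≤ p.lev k η :=
  ciInf_le (p.bddBelow_lev η) k

theorem le_meas {p : TreeCond M} {η : List X} {a : I} (h : ∀ k, a ≤ p.lev k η) :
    a ≤ p.meas η :=
  le_ciInf (f := fun k => (p.lev k η : ℝ)) fun k => h k

/-- Condition (δ) lets the infimum over levels pass through `F`: as there are finitely many
successors, a single level brings all their values close enough to their limits. -/
theorem subharm_meas (p : TreeCond M) (hf : M.StronglyFinitary) (hn : M.Nice) :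
    p.Subharm p.meas := by
  intro η
  rw [← Subtype.coe_le_coe]
  refine le_of_forall_pos_le_add fun ε hε => ?_
  obtain ⟨r', hr', h⟩ := hn.semicont (p.t η) p.meas ε hε
  have hk : ∀ ν ∈ (p.t η).1.pos, ∃ k, (p.lev k ν : ℝ) < r' ν := fun ν hν =>
    exists_lt_of_ciInf_lt (hr' ν hν)
  choose! k hk using hk
  obtain ⟨N, hN⟩ := ((hf.finite_pos (p.t η)).image k).bddAbove
  have h1 := h (p.lev N) fun ν hν => ⟨p.meas_le_lev ν N,
    lt_of_le_of_lt (Subtype.coe_le_coe.2 (p.lev_antitone hn ν (hN ⟨ν, hν, rfl⟩))) (hk ν hν)⟩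
  rw [← p.lev_succ] at h1
  exact (Subtype.coe_le_coe.2 (p.meas_le_lev _ (N + 1))).trans h1.le

theorem isBranch_mem {p : TreeCond M} {x : ℕ → X} (h : IsBranch p.T x) {k : ℕ}
    (hk : p.root.length ≤ k) : restr x k ∈ p.T := by
  obtain ⟨m, hm⟩ := h
  have h1 := hm (max k m) (le_max_right _ _)
  refine p.convex _ _ ?_ (restr_prefix x (le_max_left k m)) h1
  rw [eq_restr_of_prefix (p.root_prefix _ h1)]
  exact restr_prefix x hk

/-- Each level of the tree is a front. Together with `subharm_meas` and `Subharm.le_mu` this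
identifies the measure of the root with `mu`, so levels suffice. -/
theorem mu_le_meas (p : TreeCond M) : p.mu ≤ p.meas p.root := by
  refine le_ciInf fun k => csInf_le ⟨0, ?_⟩ ?_
  · rintro a ⟨A, v, -, -, rfl⟩
    exact v.2.1
  · refine ⟨{η | η ∈ p.T ∧ η.length = p.root.length + k}, p.lev k p.root, ⟨fun η h => h.1, ?_⟩,
      ?_, rfl⟩
    · intro x hx
      exact ⟨p.root.length + k, isBranch_mem hx (by omega), length_restr _ _⟩
    · have key : ∀ j (η : p.T), (η : List X).length + j = p.root.length + k →
          Val p {η | η ∈ p.T ∧ η.length = p.root.length + k} (fun _ => 1) η (p.lev j η) := by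
        intro j
        induction j with
        | zero => intro η h; exact Val.front _ ⟨η.2, h⟩
        | succ j ih =>
          intro η h
          rw [p.lev_succ]
          refine Val.step η (fun h' => ?_) _ fun ν hν => ih ⟨ν, p.mem_of_mem_pos hν⟩ ?_
          · have := h'.2
            omega
          · have := p.length_of_mem_pos hν
            simp only
            omega
      exact key k ⟨p.root, p.root_mem⟩ rfl

theorem le_lev_of_subharm_above (p : TreeCond M) (hn : M.Nice) {ν : p.T} {u : List X → I}
    (h : (p.above ν).Subharm u) (k : ℕ) {η : List X} (hη : η ∈ p.T) (hνη : (ν : List X) <+: η) :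
    u η ≤ p.lev k η := by
  induction k generalizing η with
  | zero => exact unitInterval.le_one'
  | succ k ih =>
    rw [p.lev_succ k ⟨η, hη⟩]
    refine (h ⟨η, hη, hνη⟩).trans (hn.mono _ _ _ fun ρ hρ => ?_)
    exact ih (p.mem_of_mem_pos (η := ⟨η, hη⟩) hρ)
      (hνη.trans (p.prefix_of_mem_pos (η := ⟨η, hη⟩) hρ))

/-- If all successors had measure 0, so would their average, and subharmonicity would make the node
null. -/
theorem exists_suc_meas_pos (p : TreeCond M) (hf : M.StronglyFinitary) (hn : M.Nice) :
    ∀ η ∈ {η | η ∈ p.T ∧ 0 < p.meas η}, ∃ ν ∈ {η | η ∈ p.T ∧ 0 < p.meas η},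
      StrictPrefix η ν ∧ ν.length = η.length + 1 := by
  rintro η ⟨hη, h⟩
  by_contra! hc
  have h1 : M.avg (p.t ⟨η, hη⟩) p.meas ≤ 0 := by
    refine hn.avg_le _ fun ν hν => ?_
    by_contra! hpos
    have hν' := hν
    rw [p.t_pos] at hν'
    exact hc ν ⟨hν'.1, hpos⟩ hν'.2.1 hν'.2.2
  exact absurd (lt_of_lt_of_le h ((p.subharm_meas hf hn ⟨η, hη⟩).trans h1)) (lt_irrefl _)

/-- Every node of positive measure has arbitrarily long extensions of measure close to `1`. -/
theorem exists_le_meas (p : TreeCond M) (hf : M.StronglyFinitary) (hn : M.Nice) {η : List X}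
    (hη : η ∈ p.T) (hpos : 0 < p.meas η) (N : ℕ) {a : ℝ} (ha : a < 1) :
    ∃ ν ∈ p.T, η <+: ν ∧ N ≤ ν.length ∧ a ≤ p.meas ν ∧ 0 < p.meas ν := by
  by_contra! hc
  obtain ⟨x, hx, hxS⟩ := exists_branch (p.exists_suc_meas_pos hf hn)
    (show η ∈ {η | η ∈ p.T ∧ 0 < p.meas η} from ⟨hη, hpos⟩)
  obtain ⟨hρT, hρ⟩ := hxS (η.length + N) (by omega)
  have hηρ : η <+: restr x (η.length + N) := by
    conv_lhs => rw [← hx]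
    exact restr_prefix x (by omega)
  have hρN : N ≤ (restr x (η.length + N)).length := by rw [length_restr]; omega
  generalize restr x (η.length + N) = ρ at hρT hρ hηρ hρN
  -- Assuming the claim fails, all measures above the long node `ρ` of positive measure stay below
  -- `a`.
  have hlt : ∀ ν ∈ p.T, ρ <+: ν → (p.meas ν : ℝ) < a ∨ p.meas ν = 0 := by
    intro ν hν h
    by_contra! h1
    exact absurd (hc ν hν (hηρ.trans h) (hρN.trans h.length_le) h1.1)
      (not_le.2 (unitInterval.pos_iff_ne_zero.2 h1.2))
  have hρr : (0 : ℝ) < p.meas ρ := hρ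
  have ha0 : 0 < a := by
    rcases hlt ρ hρT (List.prefix_refl _) with h | h
    · exact hρr.trans h
    · rw [h] at hρ; exact absurd hρ (lt_irrefl _)
  -- Dividing the measure by `a` keeps it within `[0,1]` above `ρ`, and homogeneity keeps it
  -- subharmonic. Hence it is bounded by the measure at `ρ`, which is impossible as `a < 1`. The
  -- `min` only makes `u` total.
  let u : List X → I := fun ν => ⟨min 1 (p.meas ν / a),
    le_min zero_le_one (div_nonneg (p.meas ν).2.1 ha0.le), min_le_left _ _⟩
  let b : I := ⟨a, ha0.le, ha.le⟩
  have hu : ∀ ν ∈ p.T, ρ <+: ν → p.meas ν = b * u ν := by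
    intro ν hν h
    apply Subtype.ext
    have h1 : (p.meas ν : ℝ) / a ≤ 1 := by
      rw [div_le_one ha0]
      rcases hlt ν hν h with h | h
      · exact h.le
      · rw [h]; exact ha0.le
    simp only [Set.Icc.coe_mul, u, b, min_eq_right h1]
    field_simp
  have hsub : (p.above ⟨ρ, hρT⟩).Subharm u := by
    rintro ⟨ν, hν, h⟩
    have h1 := p.subharm_meas hf hn ⟨ν, hν⟩
    rw [MeasuredTriple.avg_congr (r' := fun ν => b * u ν) _ fun ξ hξ =>
      hu ξ (p.mem_of_mem_pos hξ) (h.trans (p.prefix_of_mem_pos hξ)), hn.homogeneous] at h1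
    simp only [hu ν hν h] at h1
    rw [← Subtype.coe_le_coe, Set.Icc.coe_mul, Set.Icc.coe_mul] at h1
    exact le_of_mul_le_mul_left (a := a) h1 ha0
  have h2 : u ρ ≤ p.meas ρ := le_meas fun k =>
    p.le_lev_of_subharm_above hn hsub k hρT (List.prefix_refl _)
  have h3 := hu ρ hρT (List.prefix_refl _)
  have h4 : (p.meas ρ : ℝ) = a * u ρ := by
    have := congrArg (Subtype.val) h3
    simpa [b] using this
  have h5 : (u ρ : ℝ) ≤ p.meas ρ := h2
  nlinarith [(u ρ).2.1]

/-- The branchwise form passes directly to subtrees, whose branches are branches of the larger tree.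
-/
theorem normsLarge_iff (p : TreeCond M) : p.NormsLarge ↔ ∀ (n : ℕ) (x : ℕ → X), IsBranch p.T x →
    ∃ k, ∀ ρ : p.T, StrictPrefix (restr x k) ρ → (n : ℝ≥0) ≤ (p.t ρ).1.nor := by
  constructor
  · intro h n x hx
    obtain ⟨A, hA, hA'⟩ := h n
    obtain ⟨k, hk⟩ := hA.2 x hx
    exact ⟨k, hA' _ hk⟩
  · intro h n
    refine ⟨{ν | ν ∈ p.T ∧ ∀ ρ : p.T, StrictPrefix ν ρ → (n : ℝ≥0) ≤ (p.t ρ).1.nor},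
      ⟨fun ν h => h.1, ?_⟩, fun ν h => h.2⟩
    intro x hx
    obtain ⟨k, hk⟩ := h n x hx
    exact ⟨max k p.root.length, isBranch_mem hx (le_max_right _ _), fun ρ hρ =>
      hk ρ (hρ.of_prefix (restr_prefix x (le_max_left _ _)))⟩

theorem NormsLarge.above {p : TreeCond M} (h : p.NormsLarge) (ν : p.T) :
    (p.above ν).NormsLarge := by
  rw [normsLarge_iff] at h ⊢
  intro n x ⟨m, hm⟩
  obtain ⟨k, hk⟩ := h n x ⟨m, fun l hl => (hm l hl).1⟩
  exact ⟨k, fun ρ => hk ⟨ρ, ρ.2.1⟩⟩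

end TreeCond

namespace MtCond

theorem meas_root_pos (p : MtCond M) : 0 < p.meas p.root := by
  have h : (0 : ℝ) < p.meas p.root := p.mu_pos.trans_le p.mu_le_meas
  exact h

/-- Every condition has a stronger one with a long root, large measure and large norms. -/
theorem exists_large (p : MtCond M) (hf : M.StronglyFinitary) (hn : M.Nice) (n N : ℕ) {a : ℝ}
    (ha : a < 1) : ∃ r : MtCond M, p ≤ r ∧ a ≤ r.meas r.root ∧ N ≤ r.root.length ∧
      ∀ η : r.T, (n : ℝ≥0) ≤ (r.t η).1.nor := by
  -- Following a branch through nodes of positive measure reaches a point above which the norms are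
  -- large without losing positivity; density is applied from there.
  obtain ⟨x, hx, hxS⟩ := exists_branch (p.exists_suc_meas_pos hf hn)
    (show p.root ∈ {η | η ∈ p.T ∧ 0 < p.meas η} from ⟨p.root_mem, p.meas_root_pos⟩)
  obtain ⟨k, hk⟩ := p.normsLarge_iff.1 p.norms n x ⟨_, fun l hl => (hxS l hl).1⟩
  obtain ⟨hT, hpos⟩ := hxS (max k p.root.length) (le_max_right _ _)
  -- The norm bound holds only at proper extensions of `restr x k`, hence the extra 1 in the
  -- required length.
  obtain ⟨ν, hν, hpre, hlen, hm, hνpos⟩ :=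
    p.exists_le_meas hf hn hT hpos (max N (max k p.root.length + 1)) ha
  have hsub := (p.subharm_meas hf hn).above ⟨ν, hν⟩
  have hmu := hsub.le_mu hn
  refine ⟨⟨p.above ⟨ν, hν⟩, p.norms.above _, lt_of_lt_of_le hνpos hmu⟩, ?_, ?_, ?_, ?_⟩
  · exact ⟨fun η h => h.1, fun η => M.self_mem _⟩
  · exact hm.trans (hmu.trans (TreeCond.mu_le_meas _))
  · exact (le_max_left _ _).trans hlen
  · rintro ⟨η, hη, h⟩
    refine hk ⟨η, hη⟩ ⟨(restr_prefix x (le_max_left _ _)).trans (hpre.trans h), fun e => ?_⟩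
    have h1 := h.length_le
    have h2 := congrArg List.length e
    rw [length_restr] at h2
    simp only at h2 h1
    have := le_max_left k p.root.length
    have := le_max_right N (max k p.root.length + 1)
    omega

end MtCond

end MeasuredCreature

/-! ### Unravelling systems of creatures into trees -/

namespace MeasuredCreature

variable {X : Type u} {H : ℕ → Set X} {D : Type u} {M : MeasuredTriple H D}

/-- A set of states, each carrying a creature, with a successor state for each possibility of the
creature. Unravelling such a system from a state yields a tree of creatures. -/
structure CreatureSystem (M : MeasuredTriple H D) where
  St : Type*
  cr : St → M.K
  next : (a : St) → (ν : List X) → ν ∈ (cr a).1.pos → St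
  root_next : ∀ a ν h, (cr (next a ν h)).1.root = ν

namespace CreatureSystem

variable (S : CreatureSystem M)

/-- The node of a state. -/
def node (a : S.St) : List X := (S.cr a).1.root

/-- The states that are `n` steps away from a given one. -/
inductive Reach (a₀ : S.St) : ℕ → S.St → Prop
  | zero : Reach a₀ 0 a₀
  | succ {n : ℕ} {a : S.St} (ν : List X) (h : ν ∈ (S.cr a).1.pos) (ha : Reach a₀ n a) :
      Reach a₀ (n + 1) (S.next a ν h)

variable {S} {a₀ a b : S.St} {n m : ℕ}

theorem node_next (ν : List X) (h : ν ∈ (S.cr a).1.pos) : S.node (S.next a ν h) = ν :=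
  S.root_next a ν h

theorem strictPrefix_of_mem_pos {ν : List X} (h : ν ∈ (S.cr a).1.pos) :
    StrictPrefix (S.node a) ν :=
  ((S.cr a).1.pos_sub ν h).2.1

theorem length_of_mem_pos {ν : List X} (h : ν ∈ (S.cr a).1.pos) :
    ν.length = (S.node a).length + 1 :=
  ((S.cr a).1.pos_sub ν h).2.2

theorem Reach.length (h : S.Reach a₀ n a) : (S.node a).length = (S.node a₀).length + n := by
  induction h with
  | zero => rfl
  | succ ν hν _ ih => rw [node_next, length_of_mem_pos hν, ih]; rfl

theorem Reach.prefix (h : S.Reach a₀ n a) : S.node a₀ <+: S.node a := by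
  induction h with
  | zero => exact List.prefix_refl _
  | succ ν hν _ ih => rw [node_next]; exact ih.trans (strictPrefix_of_mem_pos hν).1

/-- A node determines its initial segments, hence the whole path of states leading to it. This makes
the choice in `state` immaterial. -/
theorem Reach.eq_of_node_eq (ha : S.Reach a₀ n a) (hb : S.Reach a₀ m b)
    (h : S.node a = S.node b) : a = b := by
  have hnm : n = m := by
    have h1 := ha.length
    have h2 := hb.length
    rw [h] at h1
    omega
  subst hnm
  induction n generalizing a b with
  | zero => cases ha; cases hb; rfl
  | succ n ih =>
    cases ha with
    | @succ _ a ν hν ha =>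
      cases hb with
      | @succ _ b ξ hξ hb =>
        rw [node_next, node_next] at h
        subst h
        have hab : a = b := ih ha (hb := hb) (eq_of_prefix_length (strictPrefix_of_mem_pos hν).1
          (strictPrefix_of_mem_pos hξ).1 (by rw [ha.length, hb.length]))
        subst hab
        rfl

theorem Reach.exists_of_prefix (h : S.Reach a₀ n a) {ν : List X} (h₁ : S.node a₀ <+: ν)
    (h₂ : ν <+: S.node a) : ∃ m b, S.Reach a₀ m b ∧ S.node b = ν := by
  induction h with
  | zero => exact ⟨0, a₀, .zero, h₁.eq_of_length_le h₂.length_le⟩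
  | @succ n a ξ hξ ha ih =>
    rw [node_next] at h₂
    rcases h₂.length_le.eq_or_lt with h | h
    · exact ⟨_, _, .succ ξ hξ ha, by rw [node_next, h₂.eq_of_length h]⟩
    · refine ih (List.prefix_of_prefix_length_le h₂ (strictPrefix_of_mem_pos hξ).1 ?_)
      have := length_of_mem_pos hξ
      omega

variable (S)

/-- The nodes of the tree obtained by unravelling. -/
def nodes (a₀ : S.St) : Set (List X) := {η | ∃ n a, S.Reach a₀ n a ∧ S.node a = η}

/-- The state at a node of the unravelled tree. -/
noncomputable def state (a₀ : S.St) (η : S.nodes a₀) : S.St := η.2.choose_spec.choose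

theorem node_state (a₀ : S.St) (η : S.nodes a₀) : S.node (S.state a₀ η) = η :=
  η.2.choose_spec.choose_spec.2

theorem exists_reach_state (a₀ : S.St) (η : S.nodes a₀) : ∃ n, S.Reach a₀ n (S.state a₀ η) :=
  ⟨_, η.2.choose_spec.choose_spec.1⟩

theorem node_mem (a₀ : S.St) : S.node a₀ ∈ S.nodes a₀ := ⟨0, a₀, .zero, rfl⟩

theorem state_root (a₀ : S.St) : S.state a₀ ⟨S.node a₀, S.node_mem a₀⟩ = a₀ := by
  obtain ⟨n, hn⟩ := S.exists_reach_state a₀ ⟨S.node a₀, S.node_mem a₀⟩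
  exact hn.eq_of_node_eq .zero (S.node_state a₀ _)

theorem exists_state_next (a₀ : S.St) (η : S.nodes a₀) {ν : List X}
    (h : ν ∈ (S.cr (S.state a₀ η)).1.pos) :
    ∃ h' : ν ∈ S.nodes a₀, S.state a₀ ⟨ν, h'⟩ = S.next _ ν h := by
  obtain ⟨n, hn⟩ := S.exists_reach_state a₀ η
  have h' : ν ∈ S.nodes a₀ := ⟨_, _, .succ ν h hn, node_next ν h⟩
  refine ⟨h', ?_⟩
  obtain ⟨m, hm⟩ := S.exists_reach_state a₀ ⟨ν, h'⟩
  exact hm.eq_of_node_eq (.succ ν h hn) (by rw [S.node_state, node_next])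

theorem pos_state (a₀ : S.St) (η : S.nodes a₀) :
    (S.cr (S.state a₀ η)).1.pos = suc (S.nodes a₀) η := by
  ext ν
  constructor
  · intro h
    obtain ⟨h', -⟩ := S.exists_state_next a₀ η h
    have h1 := strictPrefix_of_mem_pos h
    have h2 := length_of_mem_pos h
    rw [S.node_state] at h1 h2
    exact ⟨h', h1, h2⟩
  · rintro ⟨⟨n, b, hb, rfl⟩, h1, h2⟩
    obtain ⟨m, hm⟩ := S.exists_reach_state a₀ η
    have hη := S.node_state a₀ η
    cases hb with
    | zero =>
      have h3 := hm.length
      rw [hη] at h3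
      omega
    | @succ n b ν hν hb =>
      rw [node_next] at h1 h2 ⊢
      have h3 := length_of_mem_pos hν
      have : S.state a₀ η = b := hm.eq_of_node_eq hb (by
        rw [hη]
        exact eq_of_prefix_length h1.1 (strictPrefix_of_mem_pos hν).1 (by omega))
      rw [this]
      exact hν

/-- A preorder on states along which every successor state lies above its predecessor relates the
states at comparable nodes. -/
theorem state_induction {R : S.St → S.St → Prop} (hrefl : ∀ a, R a a)
    (htrans : ∀ a b c, R a b → R b c → R a c) (hnext : ∀ a ν h, R a (S.next a ν h)) (a₀ : S.St)
    (η ν : S.nodes a₀) (h : (η : List X) <+: ν) : R (S.state a₀ η) (S.state a₀ ν) := by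
  obtain ⟨m, hm⟩ := S.exists_reach_state a₀ η
  have key : ∀ n b, S.Reach a₀ n b → (η : List X) <+: S.node b → R (S.state a₀ η) b := by
    intro n b hb hη
    have heq : (η : List X) = S.node b → R (S.state a₀ η) b := fun e => by
      rw [hm.eq_of_node_eq hb ((S.node_state a₀ η).trans e)]
      exact hrefl _
    induction hb with
    | zero =>
      refine heq (hη.eq_of_length_le ?_)
      rw [← S.node_state a₀ η]
      exact hm.prefix.length_le
    | @succ n a ν hν ha ih =>
      rcases hη.length_le.eq_or_lt with h | h
      · exact heq (hη.eq_of_length h)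
      · rw [node_next] at hη h
        have hpre := List.prefix_of_prefix_length_le hη (strictPrefix_of_mem_pos hν).1
          (by have := length_of_mem_pos hν; omega)
        refine htrans _ _ _ (ih hpre fun e => ?_) (hnext a ν hν)
        rw [hm.eq_of_node_eq ha ((S.node_state a₀ η).trans e)]
        exact hrefl _
  obtain ⟨n, hn⟩ := S.exists_reach_state a₀ ν
  exact key n _ hn (by rwa [S.node_state])

/-- The tree of creatures obtained by unravelling the system from a state. -/
noncomputable def unravel (a₀ : S.St) : TreeCond M where
  T := S.nodes a₀
  root := S.node a₀
  root_mem := S.node_mem a₀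
  root_prefix := by
    rintro _ ⟨n, a, h, rfl⟩
    exact h.prefix
  convex := by
    rintro ν _ h1 h2 ⟨n, a, h, rfl⟩
    exact h.exists_of_prefix h1 h2
  subset := by
    rintro _ ⟨n, a, -, rfl⟩
    exact (S.cr a).1.root_mem
  no_max := by
    intro η hη
    obtain ⟨ν, hν⟩ := (S.cr (S.state a₀ ⟨η, hη⟩)).1.pos_nonempty
    rw [S.pos_state] at hν
    exact ⟨ν, hν.1, hν.2.1⟩
  t := fun η => S.cr (S.state a₀ η)
  t_root := S.node_state a₀
  t_pos := S.pos_state a₀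

/-- If `u` is a function on states that is subharmonic, then the corresponding function on the
nodes of the unravelled tree is subharmonic. -/
theorem exists_subharm_unravel (a₀ : S.St) (u : S.St → I)
    (hu : ∀ a, ∀ r : List X → I, (∀ ν h, r ν = u (S.next a ν h)) → u a ≤ M.avg (S.cr a) r) :
    ∃ w : List X → I, (S.unravel a₀).Subharm w ∧
      ∀ η : S.nodes a₀, w η = u (S.state a₀ η) := by
  classical
  let w : List X → I := fun η => if h : η ∈ S.nodes a₀ then u (S.state a₀ ⟨η, h⟩) else 0
  have hw : ∀ η : S.nodes a₀, w η = u (S.state a₀ η) := fun η => by simp only [w, dif_pos η.2]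
  refine ⟨w, fun η => ?_, hw⟩
  rw [hw η]
  refine hu _ _ fun ν h => ?_
  obtain ⟨h', he⟩ := S.exists_state_next a₀ η h
  rw [← he]
  exact hw ⟨ν, h'⟩

end CreatureSystem

end MeasuredCreature

/-! ### Error terms, attainable values and deficits -/

namespace MeasuredCreature

variable {X : Type u}

theorem err_pos (n : ℕ) : 0 < err n := by unfold err; positivity

theorem err_succ (n : ℕ) : err (n + 1) = err n ^ 2 := by
  unfold err
  rw [pow_succ 2 n, pow_mul, inv_pow]

theorem err_le_one (n : ℕ) : err n ≤ 1 := by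
  unfold err
  exact inv_le_one_of_one_le₀ (one_le_pow₀ one_le_two)

theorem sqrt_err_succ (n : ℕ) : √(err (n + 1)) = err n := by
  rw [err_succ, Real.sqrt_sq (err_pos n).le]

theorem err_le_sqrt_err (n : ℕ) : err n ≤ √(err n) :=
  Real.le_sqrt_of_sq_le (by nlinarith [err_pos n, err_le_one n])

/-- The error is doubly exponentially small, so its square root still fits into the geometric loss
allowed by `weight` at each level. -/
theorem three_mul_sqrt_err_le {n : ℕ} (hn : 4 ≤ n) : 3 * √(err n) ≤ (2⁻¹ : ℝ) ^ (n + 1) := by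
  obtain ⟨m, rfl⟩ : ∃ m, n = m + 1 := ⟨n - 1, by omega⟩
  have hm : m + 4 ≤ 2 ^ m := by
    have h3 : 3 ≤ m := by omega
    clear hn
    induction m, h3 using Nat.le_induction with
    | base => norm_num
    | succ m _ ih => rw [pow_succ]; omega
  have h1 : (2 : ℝ) ^ (m + 4) ≤ 2 ^ 2 ^ m := pow_le_pow_right₀ one_le_two hm
  have h2 : (2 : ℝ) ^ (m + 4) = 4 * 2 ^ (m + 1 + 1) := by ring
  rw [sqrt_err_succ, err, inv_pow, ← div_eq_mul_inv, div_le_iff₀ (by positivity),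
    inv_mul_eq_div, le_div_iff₀ (by positivity)]
  have h3 : (0 : ℝ) < 2 ^ (m + 1 + 1) := by positivity
  linarith

/-- The weights `1 - 2⁻ⁿ`. -/
noncomputable def weight (n : ℕ) : I :=
  ⟨1 - 2⁻¹ ^ n, sub_nonneg.2 (pow_le_one₀ (by norm_num) (by norm_num)),
    sub_le_self _ (by positivity)⟩

theorem coe_weight (n : ℕ) : (weight n : ℝ) = 1 - 2⁻¹ ^ n := rfl

theorem coe_weight_pos {n : ℕ} (hn : n ≠ 0) : (0 : ℝ) < weight n :=
  sub_pos.2 (pow_lt_one₀ (by norm_num) (by norm_num) hn)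

theorem weight_le_mul_self (n : ℕ) : (weight n : ℝ) ≤ weight (n + 1) * weight (n + 1) := by
  have h : (2⁻¹ : ℝ) ^ n = 2 * 2⁻¹ ^ (n + 1) := by rw [pow_succ]; ring
  rw [coe_weight, coe_weight, h]
  nlinarith [sq_nonneg ((2⁻¹ : ℝ) ^ (n + 1))]

variable {H : ℕ → Set X} {D : Type u} {M : MeasuredTriple H D}

/-- `Attains p G k j η v`: on the part of `p` above `η` there is a stronger well-founded tree, of
height at most `j`, with all norms at least `k` and all terminal nodes in `G`, such that the value
at `η` computed from the constant function `1` on the terminal nodes is `v`. -/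
inductive Attains (p : TreeCond M) (G : Set (List X)) (k : ℕ) : ℕ → List X → I → Prop
  | terminal (j : ℕ) {η : List X} (h : η ∈ G) : Attains p G k j η 1
  | step {j : ℕ} (η : p.T) (s : M.K) (hs : s ∈ M.comp (p.t η)) (hk : (k : ℝ≥0) ≤ s.1.nor)
      (f : List X → I) (hf : ∀ ν ∈ s.1.pos, Attains p G k j ν (f ν))
      (hpos : ∀ ν ∈ s.1.pos, 0 < f ν) : Attains p G k (j + 1) η (M.avg s f)

variable {p : TreeCond M} {G : Set (List X)} {k : ℕ}

theorem Attains.mono {j j' : ℕ} {η : List X} {v : I} (h : Attains p G k j η v) (hj : j ≤ j') :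
    Attains p G k j' η v := by
  induction h generalizing j' with
  | terminal j h => exact .terminal _ h
  | step η s hs hk f _ hpos ih =>
    obtain ⟨j', rfl⟩ : ∃ i, j' = i + 1 := ⟨j' - 1, by omega⟩
    exact .step η s hs hk f (fun ν hν => ih ν hν (by omega)) hpos

/-- The supremum of the values attained at a node. -/
noncomputable def best (p : TreeCond M) (G : Set (List X)) (k : ℕ) (η : List X) : I :=
  ⟨sSup {a | ∃ j, ∃ v : I, Attains p G k j η v ∧ a = v},
    Real.sSup_nonneg (by rintro _ ⟨_, v, -, rfl⟩; exact v.2.1),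
    Real.sSup_le (by rintro _ ⟨_, v, -, rfl⟩; exact v.2.2) zero_le_one⟩

theorem Attains.le_best {j : ℕ} {η : List X} {v : I} (h : Attains p G k j η v) :
    v ≤ best p G k η :=
  le_csSup (⟨1, by rintro _ ⟨_, v, -, rfl⟩; exact v.2.2⟩ :
    BddAbove {a : ℝ | ∃ j, ∃ v : I, Attains p G k j η v ∧ a = v}) ⟨j, v, h, rfl⟩

theorem exists_attains_of_lt_best {η : List X} {b : ℝ} (hb : 0 ≤ b) (h : b < best p G k η) :
    ∃ j v, b < (v : I) ∧ Attains p G k j η v := by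
  have h' : b < sSup {a : ℝ | ∃ j, ∃ v : I, Attains p G k j η v ∧ a = v} := h
  have hne : {a : ℝ | ∃ j, ∃ v : I, Attains p G k j η v ∧ a = v}.Nonempty := by
    by_contra hne
    rw [Set.not_nonempty_iff_eq_empty] at hne
    rw [hne, Real.sSup_empty] at h'
    exact absurd (hb.trans_lt h') (lt_irrefl _)
  obtain ⟨_, ⟨j, v, hv, rfl⟩, hlt⟩ := exists_lt_of_lt_csSup hne h'
  exact ⟨j, v, hlt, hv⟩

/-- Near-optimal trees at the finitely many successors combine into one tree at the node.
Approximating by `c * best` with `c < 1` lets homogeneity pull out `c`, so no continuity from below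
is needed; positivity of `best` makes the approximation strict. -/
theorem avg_best_le (hf : M.StronglyFinitary) (hn : M.Nice) (η : p.T) {s : M.K}
    (hs : s ∈ M.comp (p.t η)) (hk : (k : ℝ≥0) ≤ s.1.nor)
    (hpos : ∀ ν ∈ s.1.pos, 0 < best p G k ν) : M.avg s (best p G k) ≤ best p G k η := by
  have key : ∀ c : I, c < 1 → c * M.avg s (best p G k) ≤ best p G k η := by
    intro c hc
    have hlt : ∀ ν ∈ s.1.pos, ((c * best p G k ν : I) : ℝ) < best p G k ν := by
      intro ν hν
      rw [Set.Icc.coe_mul]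
      exact mul_lt_of_lt_one_left (hpos ν hν) hc
    have hex : ∀ ν ∈ s.1.pos, ∃ j v, ((c * best p G k ν : I) : ℝ) < (v : I) ∧
        Attains p G k j ν v := fun ν hν => exists_attains_of_lt_best (c * best p G k ν).2.1 (hlt ν hν)
    choose! j f hcf hjf using hex
    obtain ⟨J, hJ⟩ := ((hf.finite_pos s).image j).bddAbove
    have h1 : Attains p G k (J + 1) η (M.avg s f) :=
      .step η s hs hk f (fun ν hν => (hjf ν hν).mono (hJ ⟨ν, hν, rfl⟩)) fun ν hν =>
        lt_of_le_of_lt (unitInterval.nonneg' (t := c * best p G k ν)) (hcf ν hν)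
    rw [← hn.homogeneous]
    exact (hn.mono _ _ _ fun ν hν => (hcf ν hν).le).trans h1.le_best
  by_contra! hlt
  rw [← Subtype.coe_lt_coe] at hlt
  set A : ℝ := Subtype.val (M.avg s (best p G k))
  set B : ℝ := Subtype.val (best p G k η)
  have hB : 0 ≤ B := (best p G k η).2.1
  have hA : 0 < A := hB.trans_lt hlt
  -- This `c` gives `c * A = (A + B) / 2`, the midpoint, which exceeds `B`.
  have hc1 : (A + B) / (2 * A) < 1 := by rw [div_lt_one (by positivity)]; linarith
  have h := key ⟨(A + B) / (2 * A), by positivity, hc1.le⟩ hc1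
  rw [← Subtype.coe_le_coe, Set.Icc.coe_mul] at h
  have h2 : (A + B) / (2 * A) * A ≤ B := h
  rw [div_mul_eq_mul_div, div_le_iff₀ (by positivity)] at h2
  nlinarith

/-- A node is deficient if the values attained at the node fall short of the measure by an amount
that is not negligible. -/
def Deficient (p : TreeCond M) (G : Set (List X)) (k : ℕ) (η : List X) : Prop :=
  √(err η.length) ≤ (p.meas η : ℝ) - best p G k η

open Classical in
/-- The deficit at a node, replaced by `0` if it is negligible. -/
noncomputable def deficit (p : TreeCond M) (G : Set (List X)) (k : ℕ) (η : List X) : I :=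
  if h : Deficient p G k η then ⟨(p.meas η : ℝ) - best p G k η, (Real.sqrt_nonneg _).trans h,
    (sub_le_self _ (best p G k η).2.1).trans (p.meas η).2.2⟩ else 0

theorem Deficient.coe_deficit {η : List X} (h : Deficient p G k η) :
    (deficit p G k η : ℝ) = (p.meas η : ℝ) - best p G k η := by
  rw [deficit, dif_pos h]

theorem deficient_of_deficit_pos {η : List X} (h : 0 < deficit p G k η) : Deficient p G k η := by
  by_contra hc
  rw [deficit, dif_neg hc] at h
  exact absurd h (lt_irrefl _)

theorem Deficient.sqrt_le {η : List X} (h : Deficient p G k η) :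
    √(err η.length) ≤ deficit p G k η := by
  rw [h.coe_deficit]; exact h

theorem Deficient.not_mem {η : List X} (h : Deficient p G k η) : η ∉ G := by
  intro hG
  have h1 : (1 : I) ≤ best p G k η := (Attains.terminal 0 hG).le_best
  have h2 : (1 : ℝ) ≤ best p G k η := h1
  have h3 := (p.meas η).2.2
  have h4 : √(err η.length) ≤ (p.meas η : ℝ) - best p G k η := h
  have h5 := Real.sqrt_pos.2 (err_pos η.length)
  linarith

/-- At a deficient node the creature can be shrunk so that only deficient nodes remain and the
deficit is almost subharmonic. -/
theorem Deficient.exists_comp (hf : M.StronglyFinitary) (hn : M.Nice) {η : p.T}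
    (h : Deficient p G k η) (hlen : 4 ≤ (η : List X).length)
    (hnor : ((k + 4 : ℕ) : ℝ≥0) ≤ (p.t η).1.nor) :
    ∃ s ∈ M.comp (p.t η), ((p.t η).1.nor : ℝ) - 1 ≤ s.1.nor ∧
      (∀ ν ∈ s.1.pos, Deficient p G k ν) ∧
      (deficit p G k η : ℝ) - 3 * err (η : List X).length ≤ M.avg s (deficit p G k) := by
  classical
  set g := best p G k with hg
  set d := deficit p G k with hd
  set e := err (η : List X).length with he
  have he0 : 0 < e := err_pos _
  have hroot := p.t_root η
  have hnor' : (k : ℝ) + 4 ≤ ((p.t η).1.nor : ℝ) := by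
    have := NNReal.coe_le_coe.2 hnor
    push_cast at this
    exact this
  have hk0 : (0 : ℝ) ≤ k := Nat.cast_nonneg k
  have hsub := Subtype.coe_le_coe.2 (p.subharm_meas hf hn η)
  have hdη : (d η : ℝ) = p.meas η - g η := h.coe_deficit
  have hsd : √e ≤ d η := h.sqrt_le
  have hee : e ≤ √e := err_le_sqrt_err _
  have hgη : (0 : ℝ) ≤ g η := (g η).2.1
  -- The measure splits pointwise as `r₀ + d`: at deficient successors into attainable part and
  -- deficit, elsewhere entirely into `r₀`.
  let r₀ : List X → I := fun ν => if Deficient p G k ν then g ν else p.meas ν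
  obtain ⟨c, s, hs, hc, hsc⟩ := hn.split (p.t η)
    (by rw [← NNReal.coe_lt_coe]; push_cast; linarith) p.meas ![r₀, d] (fun ν _ => by
      simp only [Matrix.cons_val_zero, Matrix.cons_val_one, r₀]
      split_ifs with hν
      · rw [hd, hν.coe_deficit]; linarith
      · linarith [(d ν).2.1]) (by rw [hroot]; linarith)
  rw [hroot] at hc
  -- A second splitting, of `r₀` into `best` and the constant `e`. The `best` part contributes at
  -- most `g η` by `avg_best_le`, as two shrinkings leave the norm above `k`; the constant
  -- contributes at most `e`, and the factor `1 - e` costs another `e`.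
  have hc0 : c 0 ≤ g η + 2 * e := by
    by_cases hpos : 0 < c 0
    swap
    · linarith
    obtain ⟨hn0, hp0, hF0⟩ := hsc 0 hpos
    simp only [Matrix.cons_val_zero] at hF0 hp0
    have hroot0 : (s 0).1.root = η := (M.root_eq _ _ (hs 0)).trans hroot
    by_cases hsm : e ≤ M.avg (s 0) r₀
    swap
    · linarith
    let ee : I := ⟨e, he0.le, err_le_one _⟩
    obtain ⟨c', s', hs', hc', hsc'⟩ := hn.split (s 0)
      (by rw [← NNReal.coe_lt_coe]; push_cast; linarith) r₀ ![g, fun _ => ee] (fun ν hν => by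
        simp only [Matrix.cons_val_zero, Matrix.cons_val_one, r₀]
        split_ifs with hν'
        · linarith
        -- The threshold is chosen so that the square root of the error one level up equals the
        -- error `e` at this level.
        · have h1 : (p.meas ν : ℝ) - g ν < √(err ν.length) := not_le.1 hν'
          rw [p.length_of_mem_pos (MeasuredTriple.pos_subset (hs 0) hν), sqrt_err_succ] at h1
          change _ ≤ (g ν : ℝ) + e
          linarith) (by rw [hroot0]; exact hsm)
    rw [hroot0] at hc'
    have h1 : c' 1 ≤ e := by
      by_cases hpos' : 0 < c' 1
      swap
      · linarith
      obtain ⟨-, -, hF⟩ := hsc' 1 hpos'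
      refine hF.trans ?_
      have := hn.avg_le (s' 1) (r := fun _ => ee) (b := ee) fun _ _ => le_rfl
      exact this
    have h0 : c' 0 ≤ g η := by
      by_cases hpos' : 0 < c' 0
      swap
      · linarith
      obtain ⟨hn', hp', hF⟩ := hsc' 0 hpos'
      refine hF.trans ?_
      have := avg_best_le (G := G) hf hn η (M.trans _ _ (hs 0) (hs' 0)) (k := k)
        (by rw [← NNReal.coe_le_coe]; push_cast; linarith) fun ν hν => (hp' hν).2
      exact this
    have h2 : (M.avg (s 0) r₀ : ℝ) ≤ 1 := (M.avg (s 0) r₀).2.2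
    nlinarith
  have hm1 : (M.avg (p.t η) p.meas : ℝ) ≤ 1 := (M.avg (p.t η) p.meas).2.2
  -- One `e` comes from the first splitting and two from `hc0`. Since `d η ≥ √e` and `3 * √e < 1`,
  -- this keeps `c 1` positive, so `s 1` is usable.
  have hc1 : (d η : ℝ) - 3 * e ≤ c 1 := by nlinarith
  have hsq : √e * √e = e := Real.mul_self_sqrt he0.le
  have h3 : 3 * √e < 1 :=
    (three_mul_sqrt_err_le hlen).trans_lt (pow_lt_one₀ (by norm_num) (by norm_num) (by omega))
  have hc1pos : 0 < c 1 := by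
    have : 0 < √e := Real.sqrt_pos.2 he0
    nlinarith
  obtain ⟨hn1, hp1, hF1⟩ := hsc 1 hc1pos
  exact ⟨s 1, hs 1, hn1, fun ν hν => deficient_of_deficit_pos (hp1 hν).2, hc1.trans hF1⟩

/-- If the root of `p` is deficient then some stronger condition has only deficient nodes. -/
theorem Deficient.exists_mtCond (hf : M.StronglyFinitary) (hn : M.Nice) {p : MtCond M}
    (h : Deficient p.toTreeCond G k p.root) (hlen : 4 ≤ p.root.length)
    (hnor : ∀ η : p.T, ((k + 4 : ℕ) : ℝ≥0) ≤ (p.t η).1.nor) :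
    ∃ q : MtCond M, p ≤ q ∧ ∀ ν ∈ q.T, Deficient p.toTreeCond G k ν := by
  have hlen' : ∀ η : p.T, 4 ≤ (η : List X).length := fun η =>
    hlen.trans (p.root_length_le η.2)
  choose s hs hsnor hsd hsF using fun η : {η : p.T // Deficient p.toTreeCond G k η} =>
    η.2.exists_comp hf hn (hlen' η.1) (hnor η.1)
  let S : CreatureSystem M :=
    { St := {η : p.T // Deficient p.toTreeCond G k η}
      cr := s
      next := fun η ν hν => ⟨⟨ν, p.mem_of_mem_pos (MeasuredTriple.pos_subset (hs η) hν)⟩, hsd η ν hν⟩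
      root_next := fun η ν hν => (M.root_eq _ _ (hs _)).trans (p.t_root _) }
  have hnode : ∀ η : S.St, S.node η = η.1 := fun η => (M.root_eq _ _ (hs _)).trans (p.t_root _)
  let a₀ : S.St := ⟨⟨p.root, p.root_mem⟩, h⟩
  have hstate : ∀ η : S.nodes a₀, ((S.state a₀ η).1 : List X) = η := fun η =>
    (hnode _).symm.trans (S.node_state a₀ η)
  obtain ⟨w, hw, hw'⟩ := S.exists_subharm_unravel a₀
    (fun η => weight (η.1 : List X).length * deficit p.toTreeCond G k η.1) (by
      intro η r hr
      rw [MeasuredTriple.avg_congr (r' := fun ν => weight ((η.1 : List X).length + 1) *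
        deficit p.toTreeCond G k ν) _ fun ν hν => by
          rw [hr ν hν]
          change weight ν.length * _ = _
          rw [p.length_of_mem_pos (MeasuredTriple.pos_subset (hs η) hν)], hn.homogeneous,
        ← Subtype.coe_le_coe, Set.Icc.coe_mul, Set.Icc.coe_mul]
      have h1 := hsF η
      have h2 := η.2.sqrt_le
      have h3 := three_mul_sqrt_err_le (hlen' η.1)
      have h4 : √(err (η.1 : List X).length) * √(err (η.1 : List X).length) =
        err (η.1 : List X).length := Real.mul_self_sqrt (err_pos _).le
      have h5 := Real.sqrt_nonneg (err (η.1 : List X).length)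
      change (1 - 2⁻¹ ^ (η.1 : List X).length) * _ ≤
        (1 - 2⁻¹ ^ ((η.1 : List X).length + 1)) * (M.avg (s η) _ : ℝ)
      generalize (M.avg (s η) (deficit p.toTreeCond G k) : ℝ) = F at h1 ⊢
      generalize (deficit p.toTreeCond G k η.1 : ℝ) = δ at h1 h2 ⊢
      have h6 : (2⁻¹ : ℝ) ^ ((η.1 : List X).length + 1) ≤ 1 :=
        pow_le_one₀ (by norm_num) (by norm_num)
      have h7 : (2⁻¹ : ℝ) ^ (η.1 : List X).length = 2 * 2⁻¹ ^ ((η.1 : List X).length + 1) := by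
        rw [pow_succ]; ring
      rw [h7]
      generalize (2⁻¹ : ℝ) ^ ((η.1 : List X).length + 1) = y at h3 h6 ⊢
      generalize √(err (η.1 : List X).length) = x at h2 h3 h4 h5
      rw [← h4] at h1
      have hδ : 0 ≤ δ := h5.trans h2
      -- Here `x` is the square root of the error, so the loss is `3 * x * x ≤ 3 * x * δ ≤ y * δ`:
      -- the threshold turns an additive error into a multiplicative one, which the weights absorb.
      calc (1 - 2 * y) * δ ≤ (1 - y) * ((1 - y) * δ) := by nlinarith [mul_nonneg (sq_nonneg y) hδ]
        _ ≤ (1 - y) * F := by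
          refine mul_le_mul_of_nonneg_left ?_ (by linarith)
          nlinarith)
  have hT : S.nodes a₀ ⊆ p.T := fun η hη => by
    have := (S.state a₀ ⟨η, hη⟩).1.2
    rwa [hstate] at this
  have hpt : ∀ η : S.nodes a₀, p.t (S.state a₀ η).1 = p.t ⟨η, hT η.2⟩ := fun η =>
    congrArg p.t (Subtype.ext (hstate η))
  have hmem : ∀ η : S.nodes a₀, (S.unravel a₀).t η ∈ M.comp (p.t ⟨η, hT η.2⟩) := fun η => by
    rw [← hpt]
    exact hs _
  refine ⟨⟨S.unravel a₀, ?_, ?_⟩, ⟨hT, hmem⟩, ?_⟩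
  · rw [TreeCond.normsLarge_iff]
    intro n x ⟨m, hm⟩
    -- Shrinking lowers norms by at most 1, hence `n + 1`.
    obtain ⟨l, hl⟩ := p.normsLarge_iff.1 p.norms (n + 1) x ⟨m, fun i hi => hT (hm i hi)⟩
    refine ⟨l, fun ρ hρ => ?_⟩
    have h1 := NNReal.coe_le_coe.2 (hl ⟨ρ, hT ρ.2⟩ hρ)
    have h2 := hsnor (S.state a₀ ρ)
    rw [show p.t (S.state a₀ ρ).1 = _ from hpt ρ] at h2
    push_cast at h1
    rw [← NNReal.coe_le_coe]
    push_cast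
    change (n : ℝ) ≤ (s (S.state a₀ ρ)).1.nor
    linarith
  · refine lt_of_lt_of_le ?_ (hw.le_mu hn)
    have h1 := hw' ⟨S.node a₀, S.node_mem a₀⟩
    rw [S.state_root] at h1
    change (0 : ℝ) < w (S.node a₀)
    rw [h1, Set.Icc.coe_mul]
    refine mul_pos ?_ (lt_of_lt_of_le (Real.sqrt_pos.2 (err_pos _)) h.sqrt_le)
    exact coe_weight_pos (n := p.root.length) (by omega)
  · intro ν hν
    have := (S.state a₀ ⟨ν, hν⟩).2
    rwa [hstate] at this

/-- If every condition stronger than `p` has a node in `G`, then there is a well-founded tree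
stronger than `p` with terminal nodes in `G` which has almost the same measure as `p`. -/
theorem MtCond.exists_attains (hf : M.StronglyFinitary) (hn : M.Nice) {p : MtCond M}
    (hlen : 4 ≤ p.root.length) (hnor : ∀ η : p.T, ((k + 4 : ℕ) : ℝ≥0) ≤ (p.t η).1.nor)
    (hG : ∀ q : MtCond M, p ≤ q → ∃ ν ∈ q.T, ν ∈ G) {b : ℝ} (hb0 : 0 ≤ b)
    (hb : b + √(err p.root.length) ≤ p.meas p.root) :
    ∃ j v, b < (v : I) ∧ Attains p.toTreeCond G k j p.root v := by
  refine exists_attains_of_lt_best hb0 ?_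
  by_contra! hlt
  have h : Deficient p.toTreeCond G k p.root := by
    change √(err p.root.length) ≤ (p.meas p.root : ℝ) - best p.toTreeCond G k p.root
    linarith
  obtain ⟨q, hpq, hq⟩ := h.exists_mtCond hf hn hlen hnor
  obtain ⟨ν, hν, hνG⟩ := hG q hpq
  exact (hq ν hν).not_mem hνG

end MeasuredCreature

/-! ### Stages of the fusion -/

namespace MeasuredCreature

variable {X : Type u} {H : ℕ → Set X} {D : Type u} {M : MeasuredTriple H D}

theorem Attains.exists_of_not_mem {p : TreeCond M} {G : Set (List X)} {k j : ℕ} {ν : List X} {v : I}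
    (h : Attains p G k j ν v) (hν : ν ∉ G) :
    ∃ (i : ℕ) (η : p.T) (s : M.K) (f : List X → I), j = i + 1 ∧ (η : List X) = ν ∧
      v = M.avg s f ∧ s ∈ M.comp (p.t η) ∧ (k : ℝ≥0) ≤ s.1.nor ∧
      (∀ ξ ∈ s.1.pos, Attains p G k i ξ (f ξ)) ∧ ∀ ξ ∈ s.1.pos, 0 < f ξ := by
  cases h with
  | terminal j h => exact absurd h hν
  | @step j η s hs hk f hf hpos => exact ⟨j, η, s, f, rfl, rfl, rfl, hs, hk, hf, hpos⟩

namespace MtCond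

/-- The witness `r` may depend on the node, as the fusion changes its ambient condition along the
tree. -/
theorem le_of_forall_exists {p q : MtCond M}
    (h : ∀ η : q.T, ∃ r : MtCond M, p ≤ r ∧ ∃ hr : (η : List X) ∈ r.T, q.t η ∈ M.comp (r.t ⟨η, hr⟩)) :
    p ≤ q := by
  refine ⟨fun η hη => ?_, fun η => ?_⟩
  · obtain ⟨r, ⟨hT, -⟩, hr, -⟩ := h ⟨η, hη⟩
    exact hT hr
  · obtain ⟨r, ⟨hT, ht⟩, hr, hq⟩ := h η
    exact M.trans _ _ (ht ⟨η, hr⟩) hq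

/-- The conditions at which the `n`-th stage of the construction may start: they decide the `n`-th
name, and have a long root, large measure and large norms. -/
structure Good (τ : ℕ → PName (MtCond M)) (n : ℕ) (r : MtCond M) : Prop where
  decided : (τ n).DecidedBy r
  meas : weight (n + 2) ≤ r.meas r.root
  length : n + 4 ≤ r.root.length
  nor : ∀ η : r.T, ((n + 4 : ℕ) : ℝ≥0) ≤ (r.t η).1.nor

/-- The nodes above the root of `r` at which the next stage may start. -/
def switch (τ : ℕ → PName (MtCond M)) (n : ℕ) (r : MtCond M) : Set (List X) :=
  {ν | r.root.length < ν.length ∧ ∃ r' : MtCond M, r ≤ r' ∧ r'.root = ν ∧ Good τ (n + 1) r'}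

variable {τ : ℕ → PName (MtCond M)}

theorem exists_good (hf : M.StronglyFinitary) (hn : M.Nice) (hτ : ∀ n, (τ n).IsOrdinalName)
    (p : MtCond M) (n N : ℕ) : ∃ r, p ≤ r ∧ N ≤ r.root.length ∧ Good τ n r := by
  obtain ⟨q, hpq, hq⟩ := (hτ n p).exists_decidedBy
  obtain ⟨r, hqr, hm, hl, hnor⟩ := q.exists_large hf hn (n + 4) (max N (n + 4))
    (a := weight (n + 2)) (sub_lt_self _ (by positivity))
  exact ⟨r, hpq.trans hqr, (le_max_left _ _).trans hl, hq.mono hqr, hm,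
    (le_max_right _ _).trans hl, hnor⟩

/-- Any condition stronger than `r` extends further to a good one for the next stage, whose root
lies in `switch`; so the core lemma applies with `switch` as `G`. -/
theorem Good.exists_attains (hf : M.StronglyFinitary) (hn : M.Nice)
    (hτ : ∀ n, (τ n).IsOrdinalName) {n : ℕ} {r : MtCond M} (h : Good τ n r) :
    ∃ j v, (weight (n + 1) : ℝ) < (v : I) ∧
      Attains r.toTreeCond (switch τ n r) n j r.root v := by
  have h4 : 4 ≤ r.root.length := by have := h.length; omega
  refine MtCond.exists_attains hf hn h4 h.nor (fun q hq => ?_) (weight (n + 1)).2.1 ?_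
  · obtain ⟨r', hqr, hl, hg⟩ := exists_good hf hn hτ q (n + 1) (r.root.length + 1)
    obtain ⟨hT, -⟩ := id hqr
    exact ⟨r'.root, hT r'.root_mem, hl, r', hq.trans hqr, rfl, hg⟩
  -- The measure is within 2⁻⁽ⁿ⁺²⁾ of 1 and the core lemma loses at most as much again.
  · have h1 : (weight (n + 2) : ℝ) ≤ r.meas r.root := h.meas
    have h2 := three_mul_sqrt_err_le h4
    have h3 : (2⁻¹ : ℝ) ^ (r.root.length + 1) ≤ 2⁻¹ ^ (n + 2) :=
      pow_le_pow_of_le_one (by norm_num) (by norm_num) (by have := h.length; omega)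
    have h5 : (2⁻¹ : ℝ) ^ (n + 1) = 2 * 2⁻¹ ^ (n + 2) := by rw [pow_succ _ (n + 1)]; ring
    have h6 := Real.sqrt_nonneg (err r.root.length)
    rw [coe_weight] at h1 ⊢
    linarith

/-- The states of the construction: at stage `n` the tree is built inside the condition `r`, and
`rank` bounds the number of steps before the next stage begins. -/
structure FusionState (τ : ℕ → PName (MtCond M)) where
  stage : ℕ
  r : MtCond M
  good : Good τ stage r
  rank : ℕ
  η : r.T
  s : M.K
  f : List X → I
  mem_comp : s ∈ M.comp (r.t η)
  le_nor : (stage : ℝ≥0) ≤ s.1.nor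
  attains : ∀ ξ ∈ s.1.pos, Attains r.toTreeCond (switch τ stage r) stage rank ξ (f ξ)
  pos : ∀ ξ ∈ s.1.pos, 0 < f ξ
  avg_pos : 0 < M.avg s f

/-- The value of a state, weighted according to the stage. -/
noncomputable def FusionState.value (a : FusionState τ) : I :=
  weight (a.stage + 1) * M.avg a.s a.f

theorem FusionState.root_eq (a : FusionState τ) : a.s.1.root = a.η :=
  (M.root_eq _ _ a.mem_comp).trans (a.r.t_root _)

theorem FusionState.value_pos (a : FusionState τ) : 0 < a.value := by
  rw [← Subtype.coe_lt_coe, value, Set.Icc.coe_mul]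
  exact mul_pos (coe_weight_pos (by omega)) a.avg_pos

theorem Good.exists_state {n : ℕ} {r : MtCond M} (h : Good τ n r) {j : ℕ} {ν : List X} {v : I}
    (ha : Attains r.toTreeCond (switch τ n r) n j ν v) (hv : 0 < v) (hν : ν ∉ switch τ n r) :
    ∃ a : FusionState τ, a.stage = n ∧ a.r = r ∧ a.rank < j ∧ (a.η : List X) = ν ∧
      a.value = weight (n + 1) * v := by
  obtain ⟨i, η, s, f, rfl, rfl, rfl, hs, hk, hf, hpos⟩ := ha.exists_of_not_mem hν
  exact ⟨⟨n, r, h, i, η, s, f, hs, hk, hf, hpos, hv⟩, rfl, rfl, Nat.lt_succ_self i, rfl, rfl⟩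

/-- Nodes of `switch` are strictly longer than the root, so the attained tree is not terminal there
and supplies a first creature. -/
theorem Good.exists_state_root (hf : M.StronglyFinitary) (hn : M.Nice)
    (hτ : ∀ n, (τ n).IsOrdinalName) {n : ℕ} {r : MtCond M} (h : Good τ n r) :
    ∃ a : FusionState τ, a.stage = n ∧ a.r = r ∧ (a.η : List X) = r.root ∧
      weight n ≤ a.value := by
  obtain ⟨j, v, hv, ha⟩ := h.exists_attains hf hn hτ
  have hv0 : 0 < v := lt_of_le_of_lt (weight (n + 1)).2.1 hv
  obtain ⟨a, h1, h2, -, h3, h4⟩ := h.exists_state ha hv0 fun h => absurd h.1 (lt_irrefl _)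
  refine ⟨a, h1, h2, h3, ?_⟩
  rw [h4, ← Subtype.coe_le_coe, Set.Icc.coe_mul]
  exact (weight_le_mul_self n).trans (mul_le_mul_of_nonneg_left hv.le (weight (n + 1)).2.1)

/-- At a switch node a new stage opens, with value at least `weight (a.stage + 1)`, making up for
the terminal value 1. Elsewhere the same well-founded tree continues and the rank drops. -/
theorem FusionState.exists_next (hf : M.StronglyFinitary) (hn : M.Nice)
    (hτ : ∀ n, (τ n).IsOrdinalName) (a : FusionState τ) {ν : List X} (hν : ν ∈ a.s.1.pos) :
    ∃ b : FusionState τ, (b.η : List X) = ν ∧ weight (a.stage + 1) * a.f ν ≤ b.value ∧ a.r ≤ b.r ∧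
      (b.stage = a.stage ∧ b.rank < a.rank ∨ b.stage = a.stage + 1) := by
  by_cases hs : ν ∈ switch τ a.stage a.r
  · obtain ⟨-, r', hr', rfl, hg⟩ := hs
    obtain ⟨b, h1, h2, h3, h4⟩ := hg.exists_state_root hf hn hτ
    exact ⟨b, h3, unitInterval.mul_le_left.trans h4, by rw [h2]; exact hr', Or.inr h1⟩
  · obtain ⟨b, h1, h2, h3, h4, h5⟩ := a.good.exists_state (a.attains ν hν) (a.pos ν hν) hs
    exact ⟨b, h4, h5.ge, h2.ge, Or.inl ⟨h1, h3⟩⟩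

end MtCond

end MeasuredCreature

/-! ### The fusion condition and its fronts -/

open MeasuredCreature MtCond in
theorem theorem1p14 {X D : Type u} (H : ℕ → Set X) (hH : ∀ m, (H m).Nontrivial)
    (M : MeasuredCreature.MeasuredTriple H D) (hfin : M.StronglyFinitary) (hnice : M.Nice)
    (p : MeasuredCreature.MtCond M)
    (τ : ℕ → PName (MeasuredCreature.MtCond M)) (hτ : ∀ n, (τ n).IsOrdinalName) :
    ∃ (q : MeasuredCreature.MtCond M) (A : ℕ → Set (List X)), p ≤ q ∧
      ∀ n, MeasuredCreature.IsFront q.T (A n) ∧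
        ∀ ν : q.T, (ν : List X) ∈ A n →
          ∃ r : MeasuredCreature.MtCond M,
            r.toTreeCond = q.toTreeCond.above ν ∧ (τ n).DecidedBy r := by
  choose next hη hval hle hstage using
    fun (a : FusionState τ) (ν : List X) (hν : ν ∈ a.s.1.pos) => a.exists_next hfin hnice hτ hν
  let S : CreatureSystem M := ⟨FusionState τ, FusionState.s, next, fun a ν h =>
    (next a ν h).root_eq.trans (hη a ν h)⟩
  obtain ⟨r₀, hpr₀, -, hg₀⟩ := exists_good hfin hnice hτ p 0 0
  obtain ⟨a₀, hstage₀, hr₀, -, -⟩ := hg₀.exists_state_root hfin hnice hτ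
  let st : S.nodes a₀ → FusionState τ := S.state a₀
  have hnode : ∀ η, ((st η).η : List X) = η := fun η =>
    (st η).root_eq.symm.trans (S.node_state a₀ η)
  have hcomp : ∀ η : S.nodes a₀, ∃ h : (η : List X) ∈ (st η).r.T,
      (S.unravel a₀).t η ∈ M.comp ((st η).r.t ⟨η, h⟩) := fun η =>
    ⟨hnode η ▸ (st η).η.2, by
      have := (st η).mem_comp
      rwa [show (st η).η = ⟨η, hnode η ▸ (st η).η.2⟩ from Subtype.ext (hnode η)] at this⟩
  have hr : ∀ η ν : S.nodes a₀, (η : List X) <+: ν → (st η).r ≤ (st ν).r :=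
    S.state_induction (R := fun a b : FusionState τ => a.r ≤ b.r) (fun _ => le_rfl)
      (fun _ _ _ => le_trans) hle a₀
  have hst : ∀ η ν : S.nodes a₀, (η : List X) <+: ν → (st η).stage ≤ (st ν).stage :=
    S.state_induction (R := fun a b : FusionState τ => a.stage ≤ b.stage) (fun _ => le_rfl)
      (fun _ _ _ => le_trans) (fun a ν h => by
        change a.stage ≤ (next a ν h).stage
        rcases hstage a ν h with h | h <;> omega) a₀
  have hroot : st ⟨S.node a₀, S.node_mem a₀⟩ = a₀ := S.state_root a₀
  -- The weight factors out by homogeneity, and `hval` bounds the weighted values `f ν` by the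
  -- values of the next states.
  obtain ⟨w, hw, hwst⟩ := S.exists_subharm_unravel a₀ FusionState.value (by
    intro a f hf
    change weight (a.stage + 1) * M.avg a.s a.f ≤ M.avg a.s f
    rw [← hnice.homogeneous]
    refine hnice.mono _ _ _ fun ν hν => ?_
    rw [hf ν hν]
    exact hval a ν hν)
  have hwpos : ∀ η : S.nodes a₀, 0 < w η := fun η => by
    rw [hwst]
    exact (st η).value_pos
  -- All nodes of stage `n` are taken, not only the first on each branch; fronts need not be
  -- antichains here.
  let A : ℕ → Set (List X) := fun n => {η | ∃ h : η ∈ S.nodes a₀, (st ⟨η, h⟩).stage = n}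
  have hA : ∀ n, IsFront (S.nodes a₀) (A n) := by
    refine fun n => ⟨fun η h => h.1, fun x hx => ?_⟩
    have hmem : ∀ k, (S.node a₀).length ≤ k → restr x k ∈ S.nodes a₀ := fun k hk =>
      TreeCond.isBranch_mem (p := S.unravel a₀) hx hk
    have hsucc : ∀ k (hk : restr x k ∈ S.nodes a₀) (hk' : restr x (k + 1) ∈ S.nodes a₀),
        (st ⟨_, hk'⟩).stage = (st ⟨_, hk⟩).stage ∧ (st ⟨_, hk'⟩).rank < (st ⟨_, hk⟩).rank ∨
          (st ⟨_, hk'⟩).stage = (st ⟨_, hk⟩).stage + 1 := by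
      intro k hk hk'
      have hpos : restr x (k + 1) ∈ (S.cr (S.state a₀ ⟨_, hk⟩)).1.pos := by
        rw [S.pos_state]
        refine ⟨hk', ⟨restr_prefix x k.le_succ, fun e => ?_⟩, by simp only [length_restr]⟩
        have := congrArg List.length e
        simp only [length_restr] at this
        omega
      obtain ⟨_, he⟩ := S.exists_state_next a₀ ⟨_, hk⟩ hpos
      have := hstage _ _ hpos
      change st _ = next _ _ _ at he
      rw [← he] at this
      exact this
    suffices h : ∃ k, (S.node a₀).length ≤ k ∧ restr x k ∈ A n from ⟨h.choose, h.choose_spec.2⟩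
    induction n with
    | zero =>
      have hx₀ : S.node a₀ = restr x (S.node a₀).length :=
        eq_restr_of_prefix ((S.unravel a₀).root_prefix _ (hmem _ le_rfl))
      refine ⟨(S.node a₀).length, le_rfl, ?_⟩
      rw [← hx₀]
      exact ⟨S.node_mem a₀, (congrArg FusionState.stage hroot).trans hstage₀⟩
    | succ n ih =>
      -- Within a stage the rank strictly decreases along the branch, so the stage must eventually
      -- increase, and it does so by exactly 1.
      have key : ∀ j k (hk : restr x k ∈ S.nodes a₀), (S.node a₀).length ≤ k →
          (st ⟨_, hk⟩).stage = n → (st ⟨_, hk⟩).rank < j →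
          ∃ k, (S.node a₀).length ≤ k ∧ restr x k ∈ A (n + 1) := by
        intro j
        induction j with
        | zero => intro k hk _ _ h; omega
        | succ j ihj =>
          intro k hk hl hs hj
          have hk' := hmem (k + 1) (by omega)
          rcases hsucc k hk hk' with ⟨h1, h2⟩ | h1
          · exact ihj (k + 1) hk' (by omega) (h1.trans hs) (by omega)
          · exact ⟨k + 1, by omega, hk', by rw [h1, hs]⟩
      obtain ⟨k, hl, hk, hs⟩ := ih
      exact key _ k hk hl hs (Nat.lt_succ_self _)
  have hnorms : (S.unravel a₀).NormsLarge := by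
    refine fun n => ⟨A n, hA n, ?_⟩
    rintro ν ⟨hν, rfl⟩ ρ hρ
    exact (Nat.cast_le.2 (hst ⟨ν, hν⟩ ρ hρ.1)).trans (st ρ).le_nor
  refine ⟨⟨S.unravel a₀, hnorms, lt_of_lt_of_le (hwpos ⟨_, S.node_mem a₀⟩) (hw.le_mu hnice)⟩, A,
    le_of_forall_exists fun η => ⟨(st η).r, ?_, hcomp η⟩, fun n => ⟨hA n, ?_⟩⟩
  · refine hpr₀.trans ?_
    have := hr ⟨_, S.node_mem a₀⟩ η ((S.unravel a₀).root_prefix _ η.2)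
    rwa [hroot, hr₀] at this
  -- Ambient conditions only get stronger along the tree, so the part above `ν` is stronger than the
  -- condition at `ν`, which decides the name of its stage.
  · rintro ν ⟨hν, rfl⟩
    refine ⟨⟨(S.unravel a₀).above ν, hnorms.above ν,
      lt_of_lt_of_le (hwpos ν) ((hw.above ν).le_mu hnice)⟩, rfl, (st ν).good.decided.mono ?_⟩
    exact le_of_forall_exists fun η => ⟨(st ⟨η, η.2.1⟩).r, hr ν ⟨η, η.2.1⟩ η.2.2, hcomp ⟨η, η.2.1⟩⟩
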